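/- Let $\mathcal P=(Q,\Gamma,\Delta,q_{\mathrm{in}})$ be a pushdown system: $Q$ is a finite set of states with initial state $q_{\mathrm{in}}$, $\Gamma$ is a nonempty finite stack alphabet, $\bot\notin\Gamma$ is the initial stack symbol, $\Gamma_\bot=\Gamma\cup\{\bot\}$, and $\Delta\subseteq Q\times\Gamma_\bot\times Q\times\Gamma_\bot^{\le 2}$, where $\bot$ can neither be written nor deleted (for $(q,A,q',\alpha)\in\Delta$: if $A\in\Gamma$ then $\alpha\in\Gamma^*$; if $A=\bot$ then $\alpha\in\Gamma^*\bot$), and for every $(q,A)\in Q\times\Gamma_\bot$ there is some $(q,A,q',\alpha)\in\Delta$. Let $Q=Q_0\cup Q_1$ be a partition and $\mathrm{col}\colon Q\to\{0,\dots,n-1\}$ a colouring. The induced pushdown game $\mathcal G$ is played on the configurations $(q,\gamma)$, $q\in Q$, $\gamma\in\Gamma^*\bot$ (top of the stack on the left), with an edge $(q,A\gamma)\to(q',\alpha\gamma)$ for every $(q,A,q',\alpha)\in\Delta$, starting in $(q_{\mathrm{in}},\bot)$; the player $i$ with $q\in Q_i$ moves from $(q,\gamma)$, which has colour $\mathrm{col}(q)$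 and stack height $\mathrm{sh}(q,\gamma)=|\gamma|-1$. Player $i\in\{0,1\}$ wins an infinite play if the least colour seen infinitely often is congruent to $i$ modulo $2$. For a nonempty finite path $w=w(0)\cdots w(r)$ starting in $(q_{\mathrm{in}},\bot)$ let $\mathrm{Reset}(w)=w(0)\cdots w(l)$ and $\mathrm{lastBump}(w)=w(l+1)\cdots w(r)$, where $l<r$ is the greatest position with $\mathrm{sh}(w(l))\le\mathrm{sh}(w(r))$; for $r=0$ let $\mathrm{Reset}(w)=\varepsilon$ and $\mathrm{lastBump}(w)=w$. Let $m$ be the least colour occurring in $\mathrm{lastBump}(w)$. The stair-score for the colour $c$ is defined by $\mathrm{StairSc}_c(\varepsilon)=0$ and $$\mathrm{StairSc}_c(w)=\begin{cases}\mathrm{StairSc}_c(\mathrm{Reset}(w))&\text{if } m>c,\\ \mathrm{StairSc}_c(\mathrm{Reset}(w))+1&\text{if } m=c,\\ 0&\text{if } m<c,\end{cases}$$ and $\mathrm{MaxStairSc}_c(w)$ is the maximum of $\mathrm{StairSc}_c$ over all prefixes of $w$. For $k\ge1$, the finite-time game $\mathcal G_k$ is played on the same graph by the same players, but a play is a finite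 path $w=w(0)\cdots w(r)$ from $(q_{\mathrm{in}},\bot)$ such that $\mathrm{MaxStairSc}_c(w)=k$ for some colour $c$ and $\mathrm{MaxStairSc}_{c'}(w(0)\cdots w(r-1))<k$ for all colours $c'$; it is won by Player $i$ if $c\equiv i \pmod 2$. In both games Player $i$ wins the game if Player $i$ has a strategy all of whose consistent plays are won by Player $i$. Theorem. Let $k_{\mathcal G}=|Q|\cdot|\Gamma|\cdot2^{|Q|\cdot n}\cdot n$. For every $k>k_{\mathcal G}$ and every $i\in\{0,1\}$, Player $i$ wins $\mathcal G$ if and only if Player $i$ wins $\mathcal G_k$. Moreover, $\mathcal G_k$ is a game on a finite tree: there are only finitely many nonempty finite paths from $(q_{\mathrm{in}},\bot)$ none of whose proper prefixes $u$ satisfies $\mathrm{MaxStairSc}_c(u)\ge k$ for some $c$. So the winner of $\mathcal G$ can be found by solving a finite reachability game. -/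

import Mathlib

namespace PushdownParity

/-- A (min-)parity game on a possibly infinite graph: every vertex belongs to Player `0` or
Player `1`, has at least one outgoing edge, and carries a colour from `{0, …, n - 1}`. -/
structure ParityGame (V : Type*) (n : ℕ) where
  owner : V → Fin 2
  edge : V → V → Prop
  exists_edge : ∀ v, ∃ v', edge v v'
  init : V
  col : V → Fin n

namespace ParityGame

variable {V : Type*} {n : ℕ} (G : ParityGame V n)

/-- Infinite plays. -/
def IsPlay (ρ : ℕ → V) : Prop :=
  ρ 0 = G.init ∧ ∀ m, G.edge (ρ m) (ρ (m + 1))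

/-- The colours that occur infinitely often in `ρ`. -/
def infColors (ρ : ℕ → V) : Set (Fin n) :=
  {c | ∃ᶠ m in Filter.atTop, G.col (ρ m) = c}

/-- `ρ` is winning for Player `i`: the least colour seen infinitely often has parity `i`. -/
def PlayWonBy (i : Fin 2) (ρ : ℕ → V) : Prop :=
  ∃ c, IsLeast (G.infColors ρ) c ∧ (c : ℕ) % 2 = (i : ℕ)

/-- `σ` is a strategy for Player `i`: at every word ending in a vertex of Player `i` it
selects a successor of that vertex. Its values at other words are irrelevant. -/
def IsStrategy (i : Fin 2) (σ : List V → V) : Prop :=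
  ∀ (w : List V) (v : V), G.owner v = i → G.edge v (σ (w ++ [v]))

/-- The infinite play `ρ` is consistent with the strategy `σ` of Player `i`. -/
def Consistent (i : Fin 2) (σ : List V → V) (ρ : ℕ → V) : Prop :=
  ∀ m, G.owner (ρ m) = i → ρ (m + 1) = σ ((List.range (m + 1)).map ρ)

/-- Player `i` wins the (infinite-duration) parity game. -/
def Wins (i : Fin 2) : Prop :=
  ∃ σ, G.IsStrategy i σ ∧ ∀ ρ, G.IsPlay ρ → G.Consistent i σ ρ → G.PlayWonBy i ρ

/-- Nonempty finite paths starting in the initial vertex. -/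
def IsFinitePath (w : List V) : Prop :=
  w.head? = some G.init ∧ w.IsChain G.edge

/-- The finite path `w` is consistent with the strategy `σ` of Player `i`. -/
def FinConsistent (i : Fin 2) (σ : List V → V) (w : List V) : Prop :=
  ∀ (u : List V) (v v' : V), (u ++ [v, v']) <+: w → G.owner v = i → v' = σ (u ++ [v])

end ParityGame

/-! Stair-scores, for words over a set `V` of vertices with stack heights `sh` and colours `col`.
A word `w(0) ⋯ w(r)` is the list `[w(0), …, w(r)]`. -/

section Scores

variable {V : Type*} {n : ℕ} (sh : V → ℕ) (col : V → Fin n)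

/-- For `w = w(0) ⋯ w(r)` this is `w(0) ⋯ w(l)`, where `l < r` is the greatest position with
`sh (w(l)) ≤ sh (w(r))`, and the empty word if there is no such position
(in particular if `r = 0`). -/
def reset (w : List V) : List V :=
  match w.getLast? with
  | none => []
  | some v => w.dropLast.rdropWhile (fun x => decide (sh v < sh x))

/-- The remaining suffix `w(l+1) ⋯ w(r)` of `w`. -/
def lastBump (w : List V) : List V :=
  w.drop (reset sh w).length

/-- The least colour occurring in a word (`⊤` for the empty word only). -/
def minCol (w : List V) : WithTop (Fin n) :=
  (w.map col).minimum

theorem reset_length_lt {w : List V} (h : w ≠ []) : (reset sh w).length < w.length := by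
  unfold reset
  rw [List.getLast?_eq_some_getLast h]
  have h1 := (List.rdropWhile_prefix (p := fun x => decide (sh (w.getLast h) < sh x))
    (l := w.dropLast)).length_le
  have h2 := List.length_pos_iff.mpr h
  simp only [List.length_dropLast] at h1 ⊢
  omega

/-- The stair-score of a word for the colour `c`. -/
def stairSc (c : Fin n) (w : List V) : ℕ :=
  if h : w = [] then 0
  else if (c : WithTop (Fin n)) < minCol col (lastBump sh w) then
    stairSc c (reset sh w)
  else if minCol col (lastBump sh w) = c then
    stairSc c (reset sh w) + 1
  else 0
termination_by w.length
decreasing_by all_goals exact reset_length_lt sh h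

/-- The maximal stair-score for the colour `c` among all prefixes of a finite word. -/
def maxStairSc (c : Fin n) (w : List V) : ℕ :=
  (Finset.range (w.length + 1)).sup fun j => stairSc sh col c (w.take j)

end Scores

/-- A deadlock-free pushdown system with states `Q` and stack alphabet `Γ`. The type `Option Γ`
is `Γ` together with the initial stack symbol, represented by `none`. A transition
`(q, A, q', α)` replaces the topmost symbol `A` by the word `α` of length at most two, whose
leftmost letter becomes the top of the stack. The initial stack symbol can neither be written
nor deleted: it occurs in `α` only if `A` is the initial stack symbol, and then exactly
once, as the last letter of `α`. -/
structure PDS (Q Γ : Type*) where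
  trans : Set (Q × Option Γ × Q × List (Option Γ))
  init : Q
  length_le_two : ∀ q A q' α, (q, A, q', α) ∈ trans → α.length ≤ 2
  bot_not_written : ∀ q (A : Γ) q' α, (q, some A, q', α) ∈ trans → none ∉ α
  bot_not_deleted : ∀ q q' α, (q, none, q', α) ∈ trans → ∃ β : List Γ, α = β.map some ++ [none]
  deadlock_free : ∀ q A, ∃ q' α, (q, A, q', α) ∈ trans

/-- A configuration `(q, γ⊥)`; the field `stack` is the word `γ` over `Γ`, top symbol first,
the initial stack symbol below it being left implicit. -/
@[ext]
structure Config (Q Γ : Type*) where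
  state : Q
  stack : List Γ

namespace Config

variable {Q Γ : Type*}

/-- The full stack content `γ⊥`. -/
def content (v : Config Q Γ) : List (Option Γ) :=
  v.stack.map some ++ [none]

/-- The stack height: the length of the stack content, minus one. -/
def sh (v : Config Q Γ) : ℕ :=
  v.content.length - 1

end Config

namespace PDS

variable {Q Γ : Type*} (P : PDS Q Γ)

/-- The edges of the pushdown graph. -/
def Step (v v' : Config Q Γ) : Prop :=
  ∃ (A : Option Γ) (rest α : List (Option Γ)),
    v.content = A :: rest ∧ (v.state, A, v'.state, α) ∈ P.trans ∧ v'.content = α ++ rest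

theorem exists_step (v : Config Q Γ) : ∃ v', P.Step v v' := by
  obtain ⟨q, γ⟩ := v
  cases γ with
  | nil =>
    obtain ⟨q', α, h⟩ := P.deadlock_free q none
    obtain ⟨β, rfl⟩ := P.bot_not_deleted q q' α h
    exact ⟨⟨q', β⟩, none, [], _, rfl, h, by simp [Config.content]⟩
  | cons A γ =>
    obtain ⟨q', α, h⟩ := P.deadlock_free q (some A)
    have hα : ∃ β : List Γ, α = β.map some := by
      have hn := P.bot_not_written q A q' α h
      clear h
      induction α with
      | nil => exact ⟨[], rfl⟩
      | cons a α ih =>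
        obtain ⟨β, rfl⟩ := ih (fun hm => hn (List.mem_cons_of_mem _ hm))
        cases a with
        | none => simp at hn
        | some b => exact ⟨b :: β, rfl⟩
    obtain ⟨β, rfl⟩ := hα
    exact ⟨⟨q', β ++ γ⟩, some A, γ.map some ++ [none], _, rfl, h, by simp [Config.content]⟩

/-- The pushdown game on the configuration graph of `P`, for a partition of the states among
the players and a colouring of the states. -/
def game {n : ℕ} (owner : Q → Fin 2) (col : Q → Fin n) : ParityGame (Config Q Γ) n where
  owner v := owner v.state
  edge := P.Step
  exists_edge := P.exists_step
  init := ⟨P.init, []⟩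
  col v := col v.state

end PDS

/-! Finite-time pushdown games: a parity game `G` on configurations, played until some stair-score
reaches the threshold `k`. -/

namespace FiniteTime

variable {Q Γ : Type*} {n : ℕ} (G : ParityGame (Config Q Γ) n) (k : ℕ)

/-- The positions (vertices of the game tree): the finite paths from the initial vertex
none of whose proper prefixes has a stair-score that reaches `k`. -/
def IsPosition (w : List (Config Q Γ)) : Prop :=
  G.IsFinitePath w ∧ ∀ c, maxStairSc Config.sh G.col c w.dropLast < k

/-- The plays: the positions in which some stair-score reaches `k`. -/
def IsPlay (w : List (Config Q Γ)) : Prop :=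
  IsPosition G k w ∧ ∃ c, maxStairSc Config.sh G.col c w = k

/-- The play `w` is winning for Player `i`: the colour whose stair-score reaches `k`
has parity `i`. -/
def PlayWonBy (i : Fin 2) (w : List (Config Q Γ)) : Prop :=
  ∃ c, maxStairSc Config.sh G.col c w = k ∧ (c : ℕ) % 2 = (i : ℕ)

/-- Player `i` wins the finite-time pushdown game with threshold `k`. -/
def Wins (i : Fin 2) : Prop :=
  ∃ σ, G.IsStrategy i σ ∧
    ∀ w, IsPlay G k w → G.FinConsistent i σ w → PlayWonBy G k i w

end FiniteTime

end PushdownParity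

/-! Both players cannot win the infinite game, and the finite-time game is determined by backward
induction on a finite tree (`exists_wins`). So everything reduces to one direction,
`wins_of_finiteTime_wins`: a strategy `σ` winning the finite-time game for Player `i` yields one
winning the infinite game.

Let `T` be the finite set of positions consistent with `σ`. Player `i` remembers a word of `T` that
ends in the current state and top symbol, and moves as `σ` does after that word. Give each stair of
the word a type: state, top symbol, and the set of exits (state reached and least colour seen when
the top symbol is first removed within `T`). As soon as two stairs of equal type enclose a piece
whose least colour has parity `i`, that piece is cut out. In the resulting reduced words each point
of a stair-score for a colour of parity `i` costs a new type (`Reduced.stairSc_le`). There are at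
most `|Q| + |Q||Γ|2^(|Q|n)` types, which is less than `k`, so a reduced word is never a finished
play and the simulation can go on.

Cutting changes the stack below the top symbol. Hence each actual stack symbol carries a frame: the
word remembered when it was pushed, and the least colour since. As exits belong to the type, a pop
can be matched by an extension of the frame's word in `T` with the same state and least colour
(`SimState.Valid.exists_next`).

Player `i` wins the simulated play: between stairs the word gains a piece with the true least colour
and loses only pieces whose least colour has parity `i`. Were the least colour seen infinitely often
of the other parity, its occurrences would pile up in the words, although `T` is finite
(`parity_of_extendCut`). -/

namespace PushdownParity

/-! ### Resets, least colours and stair-scores of words -/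

section Words

variable {V : Type*} {n : ℕ} (sh : V → ℕ) (col : V → Fin n)

@[simp]
theorem minCol_nil : minCol col ([] : List V) = ⊤ := rfl

@[simp]
theorem minCol_cons (x : V) (w : List V) :
    minCol col (x :: w) = min (col x : WithTop (Fin n)) (minCol col w) := by
  simp [minCol, List.minimum_cons]

@[simp]
theorem minCol_append (u w : List V) :
    minCol col (u ++ w) = min (minCol col u) (minCol col w) := by
  induction u with
  | nil => simp
  | cons x u ih => simp [ih, min_assoc]

theorem le_minCol_iff {c : WithTop (Fin n)} {w : List V} :
    c ≤ minCol col w ↔ ∀ x ∈ w, c ≤ col x := by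
  induction w with
  | nil => simp
  | cons x u ih => simp [ih]

theorem mem_of_minCol_eq {c : Fin n} {w : List V} (h : minCol col w = c) :
    c ∈ w.map col := by
  unfold minCol at h
  exact List.minimum_mem h

theorem ne_nil_of_minCol_eq {c : Fin n} {w : List V} (h : minCol col w = c) : w ≠ [] := by
  rintro rfl
  simp at h

/-- This is how resets are computed later: the word before an excursion is recovered once its end
`x` is lower than everything in `u` and not lower than the end of `w`. -/
theorem reset_append {w u : List V} {x : V} (hu : ∀ y ∈ u, sh x < sh y)
    (hw : ∀ y, w.getLast? = some y → sh y ≤ sh x) : reset sh (w ++ u ++ [x]) = w := by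
  simp only [reset, List.getLast?_concat, List.dropLast_concat]
  induction u using List.reverseRecOn with
  | nil =>
    rw [List.append_nil, List.rdropWhile_eq_self_iff]
    intro hl
    have := hw _ (List.getLast?_eq_some_getLast hl)
    simpa using this
  | append_singleton u y ih =>
    rw [← List.append_assoc, List.rdropWhile_concat_pos _ _ _ (by simpa using hu y (by simp))]
    exact ih fun z hz => hu z (by simp [hz])

theorem reset_prefix (w : List V) : reset sh w <+: w := by
  unfold reset
  split
  · exact List.nil_prefix
  · exact (List.rdropWhile_prefix _ _).trans (List.dropLast_prefix w)

theorem reset_prefix_dropLast (w : List V) : reset sh w <+: w.dropLast := by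
  unfold reset
  split
  · exact List.nil_prefix
  · exact List.rdropWhile_prefix _ _

theorem reset_append_lastBump (w : List V) : reset sh w ++ lastBump sh w = w := by
  obtain ⟨t, ht⟩ := reset_prefix sh w
  have h : w.drop (reset sh w).length = t := by
    conv_lhs => rw [← ht]
    exact List.drop_left' (congrArg (fun l => (reset sh l).length) ht.symm)
  rw [lastBump, h, ht]

theorem stairSc_nil (c : Fin n) : stairSc sh col c [] = 0 := by
  rw [stairSc]; simp

theorem stairSc_le_reset_add_one (c : Fin n) (w : List V) :
    stairSc sh col c w ≤ stairSc sh col c (reset sh w) + 1 := by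
  rw [stairSc]
  split_ifs <;> omega

theorem stairSc_le_maxStairSc (c : Fin n) {u w : List V} (h : u <+: w) :
    stairSc sh col c u ≤ maxStairSc sh col c w := by
  have h1 : u = w.take u.length := List.prefix_iff_eq_take.mp h
  have h2 := h.length_le
  unfold maxStairSc
  have := Finset.le_sup (f := fun j => stairSc sh col c (w.take j))
    (Finset.mem_range.mpr (Nat.lt_succ_of_le h2))
  rwa [← h1] at this

theorem maxStairSc_le_iff {c : Fin n} {w : List V} {k : ℕ} :
    maxStairSc sh col c w ≤ k ↔ ∀ u, u <+: w → stairSc sh col c u ≤ k := by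
  refine ⟨fun h u hu => (stairSc_le_maxStairSc sh col c hu).trans h, fun h => ?_⟩
  exact Finset.sup_le fun j _ => h _ (List.take_prefix _ _)

theorem maxStairSc_mono (c : Fin n) {u w : List V} (h : u <+: w) :
    maxStairSc sh col c u ≤ maxStairSc sh col c w :=
  (maxStairSc_le_iff sh col).mpr fun _ hv => stairSc_le_maxStairSc sh col c (hv.trans h)

theorem maxStairSc_eq_max (c : Fin n) (w : List V) :
    maxStairSc sh col c w = max (maxStairSc sh col c w.dropLast) (stairSc sh col c w) := by
  apply le_antisymm
  · rw [maxStairSc_le_iff]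
    intro u hu
    rcases eq_or_ne u w with rfl | hne
    · exact le_max_right _ _
    · refine le_max_of_le_left (stairSc_le_maxStairSc sh col c ?_)
      rcases List.eq_nil_or_concat w with rfl | ⟨w', x, rfl⟩
      · exact absurd (List.prefix_nil.mp hu) hne
      · rw [List.concat_eq_append] at hu hne ⊢
        rw [List.dropLast_concat]
        rcases List.prefix_concat_iff.mp hu with h | h
        · exact absurd h hne
        · exact h
  · exact max_le (maxStairSc_mono sh col c (List.dropLast_prefix w))
      (stairSc_le_maxStairSc sh col c List.prefix_rfl)

/-- One letter raises a score by at most one, since the reset is already a prefix of `w.dropLast`.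
So the threshold is hit exactly and never jumped over. -/
theorem maxStairSc_le_of_dropLast {c : Fin n} {w : List V} {k : ℕ}
    (h : maxStairSc sh col c w.dropLast < k) : maxStairSc sh col c w ≤ k := by
  rw [maxStairSc_eq_max]
  refine max_le h.le ?_
  have h1 := stairSc_le_reset_add_one sh col c w
  have h2 := stairSc_le_maxStairSc sh col c (reset_prefix_dropLast sh w)
  omega

end Words

/-! ### Stairs and limiting colours of infinite sequences -/

/-- Infinitely many stairs of a sequence of heights. -/
theorem exists_stairs (h : ℕ → ℕ) (N : ℕ) :
    ∃ t : ℕ → ℕ, (∀ j, t j < t (j + 1)) ∧ N ≤ t 0 ∧ (∀ j s, t j ≤ s → h (t j) ≤ h s) ∧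
      ∀ j s, t j < s → s < t (j + 1) → h (t (j + 1)) < h s := by
  have key : ∀ N, ∃ s, N ≤ s ∧ (∀ r, N ≤ r → h s ≤ h r) ∧ ∀ r, N ≤ r → r < s → h s < h r := by
    intro N
    have hex : ∃ s, N ≤ s ∧ ∀ r, N ≤ r → h s ≤ h r := by
      obtain ⟨_, ⟨s, hs, rfl⟩, hmin⟩ :=
        wellFounded_lt.has_min (h '' Set.Ici N) ⟨h N, N, Set.self_mem_Ici, rfl⟩
      exact ⟨s, hs, fun r hr => not_lt.mp (hmin _ ⟨r, hr, rfl⟩)⟩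
    classical
    -- The first position attaining the minimum from `N` on: everything between `N` and it is
    -- strictly higher.
    refine ⟨Nat.find hex, (Nat.find_spec hex).1, (Nat.find_spec hex).2, fun r hr hlt => ?_⟩
    have := Nat.find_min hex hlt
    push Not at this
    obtain ⟨r', hr', hlt'⟩ := this hr
    exact ((Nat.find_spec hex).2 r' hr').trans_lt hlt'
  choose nxt h1 h2 h3 using key
  let t : ℕ → ℕ := fun j => Nat.rec (nxt N) (fun _ s => nxt (s + 1)) j
  have ht : ∀ j, t (j + 1) = nxt (t j + 1) := fun j => rfl
  refine ⟨t, fun j => ?_, h1 N, fun j => ?_, fun j s hs hs' => ?_⟩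
  · have := h1 (t j + 1)
    rw [ht]; omega
  · cases j with
    | zero => exact fun s hs => h2 N s ((h1 N).trans hs)
    | succ j =>
      intro s hs
      rw [ht] at hs ⊢
      exact h2 _ s ((h1 _).trans hs)
  · rw [ht] at hs' ⊢
    exact h3 _ s hs hs'

/-- The least colour seen infinitely often. -/
theorem exists_liminf {n : ℕ} (c : ℕ → Fin n) :
    ∃ m, (∃ᶠ t in Filter.atTop, c t = m) ∧ ∃ N, ∀ t, N ≤ t → m ≤ c t := by
  have hne : ∃ m, ∃ᶠ t in Filter.atTop, c t = m := by
    by_contra hcon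
    push Not at hcon
    have := (Filter.eventually_all (l := Filter.atTop) (p := fun m t => c t ≠ m)).mpr
      (by simpa using hcon)
    obtain ⟨t, ht⟩ := this.exists
    exact ht _ rfl
  obtain ⟨m, hm, hmin⟩ := wellFounded_lt.has_min {m | ∃ᶠ t in Filter.atTop, c t = m} hne
  refine ⟨m, hm, ?_⟩
  have : ∀ᶠ t in Filter.atTop, ∀ d, d < m → c t ≠ d := by
    rw [Filter.eventually_all]
    intro d
    by_cases hd : d < m
    · have : ¬ ∃ᶠ t in Filter.atTop, c t = d := fun h => hmin d h hd
      exact (Filter.not_frequently.mp this).mono fun t ht _ => ht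
    · exact Filter.Eventually.of_forall fun t h => absurd h hd
  obtain ⟨N, hN⟩ := Filter.eventually_atTop.mp this
  exact ⟨N, fun t ht => not_lt.mp fun hlt => hN t ht _ hlt rfl⟩

/-! ### Parity games and strategies with memory -/

namespace ParityGame

variable {V : Type*} {n : ℕ} (G : ParityGame V n)

theorem playWonBy_of_liminf {i : Fin 2} {ρ : ℕ → V} {m : Fin n}
    (hm : ∃ᶠ t in Filter.atTop, G.col (ρ t) = m) {N : ℕ} (hN : ∀ t, N ≤ t → m ≤ G.col (ρ t))
    (hi : (m : ℕ) % 2 = i) : G.PlayWonBy i ρ := by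
  refine ⟨m, ⟨hm, fun c hc => ?_⟩, hi⟩
  obtain ⟨t, ht, rfl⟩ := Filter.frequently_atTop.mp hc N
  exact hN t ht

/-- The history of the play in which both players follow their strategies. -/
def history (σ : Fin 2 → List V → V) : ℕ → List V
  | 0 => [G.init]
  | t + 1 => history σ t ++ [σ (G.owner ((history σ t).getLastD G.init)) (history σ t)]

theorem exists_play_of_strategies (σ : Fin 2 → List V → V) (hσ : ∀ i, G.IsStrategy i (σ i)) :
    ∃ ρ, G.IsPlay ρ ∧ ∀ i, G.Consistent i (σ i) ρ := by
  let ρ : ℕ → V := fun t => (G.history σ t).getLastD G.init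
  have hlast : ∀ t, ∃ w, G.history σ t = w ++ [ρ t] := by
    intro t
    cases t with
    | zero => exact ⟨[], by simp [ρ, history]⟩
    | succ t => exact ⟨G.history σ t, by simp [ρ, history]⟩
  have hh : ∀ t, G.history σ t = (List.range (t + 1)).map ρ := by
    intro t
    induction t with
    | zero => simp [history, ρ]
    | succ t ih =>
      rw [List.range_succ, List.map_append, ← ih]
      simp [ρ, history]
  have hstep : ∀ t, ρ (t + 1) = σ (G.owner (ρ t)) (G.history σ t) := by
    intro t
    simp [ρ, history]
  refine ⟨ρ, ⟨by simp [ρ, history], fun t => ?_⟩, fun i t ht => ?_⟩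
  · rw [hstep]
    obtain ⟨w, hw⟩ := hlast t
    rw [hw]
    exact hσ _ w _ rfl
  · rw [hstep, ht, hh]

/-- Playing both strategies against each other gives a single play, whose least recurring colour has
only one parity. -/
theorem not_wins_both (h : ∀ i, G.Wins i) : False := by
  choose σ hσ hwin using h
  obtain ⟨ρ, hρ, hc⟩ := G.exists_play_of_strategies σ hσ
  obtain ⟨c, hc0, h0⟩ := hwin 0 ρ hρ (hc 0)
  obtain ⟨d, hd1, h1⟩ := hwin 1 ρ hρ (hc 1)
  have := hc0.unique hd1
  subst this
  simp at h0 h1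
  omega

/-- A strategy can be implemented by a memory that is updated along the play. -/
theorem wins_of_memory {i : Fin 2} {S : Type*} (conf : S → V) (R : S → S → Prop) (s₀ : S)
    (h0 : conf s₀ = G.init)
    (hi : ∀ s, G.owner (conf s) = i → ∃ s', R s s' ∧ G.edge (conf s) (conf s'))
    (hj : ∀ s, G.owner (conf s) ≠ i → ∀ v, G.edge (conf s) v → ∃ s', R s s' ∧ conf s' = v)
    (hwin : ∀ s : ℕ → S, s 0 = s₀ → (∀ t, R (s t) (s (t + 1))) →
      G.PlayWonBy i fun t => conf (s t)) : G.Wins i := by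
  classical
  let mv : S → S := fun s => if h : G.owner (conf s) = i then (hi s h).choose else s
  have hmv : ∀ s, G.owner (conf s) = i → R s (mv s) ∧ G.edge (conf s) (conf (mv s)) := by
    intro s h
    simp only [mv, dif_pos h]
    exact (hi s h).choose_spec
  let nx : S → V → S := fun s v => if h : ∃ s', R s s' ∧ conf s' = v then h.choose else s
  have hnx : ∀ s v, (∃ s', R s s' ∧ conf s' = v) → R s (nx s v) ∧ conf (nx s v) = v := by
    intro s v h
    simp only [nx, dif_pos h]
    exact h.choose_spec
  -- The first vertex is dropped because `s₀` already accounts for it.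
  let st : List V → S := fun w => w.tail.foldl nx s₀
  let any : V → V := fun v => (G.exists_edge v).choose
  have hany : ∀ v, G.edge v (any v) := fun v => (G.exists_edge v).choose_spec
  -- The fallback serves only to keep `σ` legal on words where the memory does not match the last
  -- vertex.
  let σ : List V → V := fun w =>
    if G.edge (w.getLastD G.init) (conf (mv (st w))) then conf (mv (st w))
    else any (w.getLastD G.init)
  refine ⟨σ, fun w v _ => ?_, fun ρ hρ hc => ?_⟩
  · simp only [σ]
    split_ifs with h
    · simpa using h
    · simpa using hany v
  · let s : ℕ → S := fun t => st ((List.range (t + 1)).map ρ)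
    have hs0 : s 0 = s₀ := by simp [s, st]
    have hs : ∀ t, s (t + 1) = nx (s t) (ρ (t + 1)) := by
      intro t
      simp only [s, st]
      rw [List.range_succ, List.map_append, List.tail_append_of_ne_nil (by simp),
        List.foldl_append]
      simp
    have hlast : ∀ t, ((List.range (t + 1)).map ρ).getLastD G.init = ρ t := by
      intro t
      rw [List.range_succ, List.map_append]
      simp
    have hex : ∀ t, conf (s t) = ρ t → ∃ s', R (s t) s' ∧ conf s' = ρ (t + 1) := by
      intro t ht
      by_cases ho : G.owner (ρ t) = i
      · have h1 := hmv (s t) (by rwa [ht])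
        refine ⟨_, h1.1, ?_⟩
        rw [hc t ho]
        simp only [σ, hlast]
        rw [if_pos]
        rw [← ht]
        exact h1.2
      · exact hj (s t) (by rwa [ht]) _ (by rw [ht]; exact hρ.2 t)
    have hconf : ∀ t, conf (s t) = ρ t := by
      intro t
      induction t with
      | zero => rw [hs0, h0, hρ.1]
      | succ t ih => rw [hs]; exact (hnx _ _ (hex t ih)).2
    have := hwin s hs0 fun t => by rw [hs]; exact (hnx _ _ (hex t (hconf t))).1
    simpa only [hconf] using this

end ParityGame

/-! ### Pushdown moves without an explicit bottom symbol -/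

theorem Config.sh_eq_length {Q Γ : Type*} (v : Config Q Γ) : v.sh = v.stack.length := by
  simp [Config.sh, Config.content]

namespace PDS

variable {Q Γ : Type*} (P : PDS Q Γ)

/-- The transition that replaces the topmost symbol `A` by `β`; the initial stack symbol, if it
is the topmost symbol, is kept below `β`. -/
def Move (q : Q) (A : Option Γ) (q' : Q) (β : List Γ) : Prop :=
  (q, A, q', β.map some ++ if A.isSome then [] else [none]) ∈ P.trans

theorem exists_eq_map_some {α : List (Option Γ)} (h : none ∉ α) :
    ∃ β : List Γ, α = β.map some := by
  induction α with
  | nil => exact ⟨[], rfl⟩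
  | cons a α ih =>
    obtain ⟨β, rfl⟩ := ih fun hm => h (List.mem_cons_of_mem _ hm)
    cases a with
    | none => simp at h
    | some b => exact ⟨b :: β, rfl⟩

theorem step_iff {v v' : Config Q Γ} :
    P.Step v v' ↔ ∃ β, P.Move v.state v.stack.head? v'.state β ∧
      v'.stack = β ++ v.stack.tail := by
  have hinj : Function.Injective (List.map (some : Γ → Option Γ)) :=
    List.map_injective_iff.mpr (Option.some_injective _)
  obtain ⟨q, γ⟩ := v
  obtain ⟨q', γ'⟩ := v'
  constructor
  · rintro ⟨A, rest, α, h1, h2, h3⟩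
    cases γ with
    | nil =>
      simp only [Config.content, List.map_nil, List.nil_append, List.cons.injEq] at h1
      obtain ⟨rfl, rfl⟩ := h1
      obtain ⟨β, rfl⟩ := P.bot_not_deleted _ _ _ h2
      refine ⟨β, by simpa [Move] using h2, ?_⟩
      have : γ'.map some = β.map some := by simpa [Config.content] using h3
      simpa using hinj this
    | cons B γ =>
      simp only [Config.content, List.map_cons, List.cons_append, List.cons.injEq] at h1
      obtain ⟨rfl, rfl⟩ := h1
      obtain ⟨β, rfl⟩ := exists_eq_map_some (P.bot_not_written _ _ _ _ h2)
      refine ⟨β, by simpa [Move] using h2, ?_⟩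
      have : γ'.map some = (β ++ γ).map some := by
        rw [List.map_append]
        simpa [Config.content, ← List.append_assoc, -List.map_append] using h3
      simpa using hinj this
  · rintro ⟨β, h, rfl⟩
    cases γ with
    | nil => exact ⟨none, [], _, rfl, h, by simp [Config.content]⟩
    | cons B γ => exact ⟨some B, γ.map some ++ [none], _, rfl, h, by simp [Config.content]⟩

variable {P}

theorem Move.length_le_two {q q' : Q} {A : Option Γ} {β : List Γ} (h : P.Move q A q' β) :
    β.length ≤ 2 := by
  have := P.length_le_two _ _ _ _ h
  simp only [List.length_append, List.length_map] at this
  omega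

theorem Move.length_le_one {q q' : Q} {β : List Γ} (h : P.Move q none q' β) :
    β.length ≤ 1 := by
  have := P.length_le_two _ _ _ _ h
  simp at this
  omega

end PDS

/-! ### Simulation of the pushdown game by words of a finite tree -/

section Simulation

variable {Q Γ : Type*} {n : ℕ} (col : Q → Fin n) (i : Fin 2) (T : Set (List (Config Q Γ)))
  (e : Config Q Γ)

/-- The colouring of configurations induced by a colouring of the states. -/
abbrev stateCol (v : Config Q Γ) : Fin n := col v.state

/-- The pairs of a state and a colour such that some word of `T` extends `w` up to the first
removal of the topmost stack symbol, reaching that state with that minimal colour. -/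
def exits (w : List (Config Q Γ)) : Set (Q × Fin n) :=
  {p | ∃ u, w ++ u ∈ T ∧ (w ++ u).getLastD e = ⟨p.1, (w.getLastD e).stack.tail⟩ ∧
    (∀ x ∈ u.dropLast, (w.getLastD e).stack.length ≤ x.stack.length) ∧
    minCol (stateCol col) u = p.2}

/-- The type of a word: its last state, its last topmost stack symbol, and its exits. -/
def wordType (w : List (Config Q Γ)) : Q ⊕ (Q × Γ × Set (Q × Fin n)) :=
  match (w.getLastD e).stack with
  | [] => Sum.inl (w.getLastD e).state
  | A :: _ => Sum.inr ((w.getLastD e).state, A, exits col T e w)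

-- Types at the bottom of the stack record no exits, whence the nonemptiness condition. Nothing is
-- lost: over an empty stack `Pending` makes no demand on exits.
variable {col T e} in
theorem of_wordType_eq {w w' : List (Config Q Γ)} (h : wordType col T e w = wordType col T e w') :
    (w.getLastD e).state = (w'.getLastD e).state ∧
    (w.getLastD e).stack.head? = (w'.getLastD e).stack.head? ∧
    ((w'.getLastD e).stack ≠ [] → exits col T e w = exits col T e w') := by
  unfold wordType at h
  split at h <;> rename_i h1 <;> split at h <;> rename_i h2
  · simp_all
  · simp at h
  · simp at h
  · simp only [Sum.inr.injEq, Prod.mk.injEq] at h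
    exact ⟨h.1, by rw [h1, h2, h.2.1]; rfl, fun _ => h.2.2⟩

/-- One application of `reset`. -/
def ResetStep (a b : List (Config Q Γ)) : Prop := b ≠ [] ∧ a = reset Config.sh b

theorem ResetStep.isPrefix {a b : List (Config Q Γ)} (h : ResetStep a b) : a <+: b :=
  h.2 ▸ reset_prefix _ b

theorem prefix_of_resetSteps {a b : List (Config Q Γ)}
    (h : Relation.ReflTransGen ResetStep a b) : a <+: b := by
  induction h with
  | refl => exact List.prefix_rfl
  | tail _ h ih => exact ih.trans h.isPrefix

/-- The least colour of the word is defined and has the parity of Player `i`. -/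
def GoodMin (z : List (Config Q Γ)) : Prop :=
  ∃ c : Fin n, minCol (stateCol col) z = (c : WithTop (Fin n)) ∧ (c : ℕ) % 2 = i

/-- No two stairs of `w` of the same type have a good minimal colour between them. -/
def Reduced (w : List (Config Q Γ)) : Prop :=
  ∀ w₂, Relation.ReflTransGen ResetStep w₂ w → ∀ w₁, w₁ ≠ [] →
    Relation.TransGen ResetStep w₁ w₂ → wordType col T e w₁ = wordType col T e w₂ →
    ¬ GoodMin col i (w₂.drop w₁.length)

variable {col i T e}

theorem Reduced.of_resetSteps {w w' : List (Config Q Γ)} (h : Reduced col i T e w)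
    (hw : Relation.ReflTransGen ResetStep w' w) : Reduced col i T e w' :=
  fun w₂ h₂ => h w₂ (h₂.trans hw)

theorem Reduced.nil : Reduced col i T e [] := by
  intro w₂ h₂ w₁ h₁ h
  have : w₂ = [] := List.prefix_nil.mp (prefix_of_resetSteps h₂)
  subst this
  exact absurd (List.prefix_nil.mp (prefix_of_resetSteps h.to_reflTransGen)) h₁

variable (col i) in
/-- `w'` arises from `w` by appending a word with minimal colour `m` and then possibly removing
a suffix with a good minimal colour. -/
def ExtendCut (w : List (Config Q Γ)) (m : WithTop (Fin n)) (w' : List (Config Q Γ)) : Prop :=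
  ∃ u z, minCol (stateCol col) u = m ∧ w ++ u = w' ++ z ∧ (z = [] ∨ GoodMin col i z)

/-- Only the last stair of the extended word is new, so only it can violate reducedness. If an
earlier stair `w₁` forms a bad pair with it, `w₁` replaces the whole word: it is reduced as a stair
of `w`, and equality of types preserves state, top symbol and exits. -/
theorem exists_reduced {w u : List (Config Q Γ)} {x : Config Q Γ}
    (hpre : ∀ w u : List (Config Q Γ), w ≠ [] → w ++ u ∈ T → w ∈ T)
    (hw : Reduced col i T e w) (hT : w ++ u ++ [x] ∈ T)
    (hu : ∀ y ∈ u, x.stack.length < y.stack.length)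
    (hlen : ∀ y, w.getLast? = some y → y.stack.length ≤ x.stack.length) :
    ∃ w' ∈ T, Reduced col i T e w' ∧ (w'.getLastD e).state = x.state ∧
      (w'.getLastD e).stack.head? = x.stack.head? ∧
      (x.stack ≠ [] → exits col T e w' = exits col T e (w ++ u ++ [x])) ∧
      ExtendCut col i w (minCol (stateCol col) (u ++ [x])) w' := by
  have hres : reset Config.sh (w ++ u ++ [x]) = w :=
    reset_append _ (by simpa [Config.sh_eq_length] using hu)
      (by simpa [Config.sh_eq_length] using hlen)
  have hstep : ResetStep w (w ++ u ++ [x]) := ⟨by simp, hres.symm⟩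
  have hlast : (w ++ u ++ [x]).getLastD e = x := by simp
  by_cases hex : ∃ w₁, w₁ ≠ [] ∧ Relation.ReflTransGen ResetStep w₁ w ∧
      wordType col T e w₁ = wordType col T e (w ++ u ++ [x]) ∧
      GoodMin col i ((w ++ u ++ [x]).drop w₁.length)
  · obtain ⟨w₁, h1, h2, h3, h4⟩ := hex
    obtain ⟨t, ht⟩ := (prefix_of_resetSteps h2).trans hstep.isPrefix
    have h5 := of_wordType_eq h3
    rw [hlast] at h5
    refine ⟨w₁, hpre w₁ t h1 (ht ▸ hT), hw.of_resetSteps h2, h5.1, h5.2.1, h5.2.2, u ++ [x], t,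
      rfl, by rw [ht, List.append_assoc], Or.inr ?_⟩
    rw [← ht, List.drop_left] at h4
    exact h4
  · refine ⟨_, hT, fun w₂ h2 w₁ h1 h12 hty hgood => ?_, by rw [hlast], by rw [hlast],
      fun _ => rfl, u ++ [x], [], rfl, by simp, Or.inl rfl⟩
    rcases Relation.ReflTransGen.cases_tail h2 with h | ⟨w₃, h23, h3⟩
    · subst h
      obtain ⟨w₃, h13, h3⟩ := Relation.TransGen.tail'_iff.mp h12
      have : w₃ = w := h3.2.trans hres
      subst this
      exact hex ⟨w₁, h1, h13, hty, hgood⟩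
    · have : w₃ = w := h3.2.trans hres
      subst this
      exact hw w₂ h23 w₁ h1 h12 hty hgood

/-- An exit of the longer word is also one of `w`, because `u` stays at least as high and the
symbols below the top are untouched. The colours of `u` are merely prepended. -/
theorem exits_append {w u : List (Config Q Γ)} {p : Q × Fin n}
    (htail : ((w ++ u).getLastD e).stack.tail = (w.getLastD e).stack.tail)
    (hu : ∀ x ∈ u, (w.getLastD e).stack.length ≤ x.stack.length)
    (hp : p ∈ exits col T e (w ++ u)) :
    ∃ c : Fin n, (p.1, c) ∈ exits col T e w ∧
      (c : WithTop (Fin n)) = min (minCol (stateCol col) u) p.2 := by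
  obtain ⟨u', h1, h2, h3, h4⟩ := hp
  have hne := ne_nil_of_minCol_eq _ h4
  have hle : (w.getLastD e).stack.length ≤ ((w ++ u).getLastD e).stack.length := by
    rcases List.eq_nil_or_concat u with rfl | ⟨u₀, x, rfl⟩
    · simp
    · rw [List.concat_eq_append] at hu ⊢
      rw [← List.append_assoc, List.getLastD_concat]
      exact hu x (by simp)
  obtain ⟨c, hc⟩ : ∃ c : Fin n, (c : WithTop (Fin n)) = min (minCol (stateCol col) u) p.2 := by
    refine WithTop.ne_top_iff_exists.mp (ne_of_lt ?_)
    exact (min_le_right _ _).trans_lt (WithTop.coe_lt_top _)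
  refine ⟨c, ⟨u ++ u', by rwa [← List.append_assoc], ?_, ?_, ?_⟩, hc⟩
  · rw [← List.append_assoc, h2, htail]
  · rw [List.dropLast_append_of_ne_nil hne]
    intro x hx
    rcases List.mem_append.mp hx with hx | hx
    · exact hu x hx
    · exact hle.trans (h3 x hx)
  · rw [minCol_append, h4, hc]

variable (col i T e) in
/-- The bookkeeping for the stack content `γ` below the initial stack symbol, when the play is
simulated by `w`. Every stack symbol owns a frame: a word `y` of `T` at which the simulation is
resumed when the symbol is removed, and the minimal colour seen since the simulation was at `y`
(apart from colours seen while frames above were present). -/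
def Pending : List Γ → List (Config Q Γ) → List (List (Config Q Γ) × WithTop (Fin n)) → Prop
  | [], _, F => F = []
  | _ :: _, _, [] => False
  | _ :: γ, w, (y, d) :: F => (y ∈ T ∧ Reduced col i T e y ∧
      ∃ δ : List Γ, δ.head? = γ.head? ∧ δ.tail = (y.getLastD e).stack.tail ∧
        δ.length = (y.getLastD e).stack.length ∧
        ∀ p ∈ exits col T e w, ∃ u, y ++ u ∈ T ∧ (y ++ u).getLastD e = ⟨p.1, δ⟩ ∧
          (∀ x ∈ u.dropLast, (y.getLastD e).stack.length < x.stack.length) ∧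
          minCol (stateCol col) u = min d p.2) ∧ Pending γ y F

/-- Record a colour in the topmost frame. -/
def updateFrame (m : WithTop (Fin n)) :
    List (List (Config Q Γ) × WithTop (Fin n)) → List (List (Config Q Γ) × WithTop (Fin n))
  | [] => []
  | (y, d) :: F => (y, min d m) :: F

theorem Pending.length_eq {γ : List Γ} {w : List (Config Q Γ)}
    {F : List (List (Config Q Γ) × WithTop (Fin n))} (h : Pending col i T e γ w F) :
    F.length = γ.length := by
  induction γ generalizing w F with
  | nil => simp [show F = [] from h]
  | cons A γ ih =>
    cases F with
    | nil => exact h.elim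
    | cons f F => simp [ih h.2]

theorem Pending.update {γ : List Γ} {w w' : List (Config Q Γ)} {m : WithTop (Fin n)}
    {F : List (List (Config Q Γ) × WithTop (Fin n))} (h : Pending col i T e γ w F)
    (hw : ∀ p ∈ exits col T e w', ∃ c : Fin n, (p.1, c) ∈ exits col T e w ∧
      (c : WithTop (Fin n)) = min m p.2) :
    Pending col i T e γ w' (updateFrame m F) := by
  cases γ with
  | nil => rw [show F = [] from h]; rfl
  | cons A γ =>
    cases F with
    | nil => exact h.elim
    | cons f F =>
      obtain ⟨⟨h1, h2, δ, h3, h4, h5, h6⟩, h7⟩ := h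
      refine ⟨⟨h1, h2, δ, h3, h4, h5, fun p hp => ?_⟩, h7⟩
      obtain ⟨c, hc, hc'⟩ := hw p hp
      obtain ⟨u, hu1, hu2, hu3, hu4⟩ := h6 _ hc
      exact ⟨u, hu1, hu2, hu3, by rw [hu4, hc', min_assoc]⟩

theorem Pending.congr {γ : List Γ} {w w' : List (Config Q Γ)}
    {F : List (List (Config Q Γ) × WithTop (Fin n))} (h : Pending col i T e γ w F)
    (hw : γ ≠ [] → exits col T e w' = exits col T e w) :
    Pending col i T e γ w' F := by
  cases γ with
  | nil => exact h
  | cons A γ =>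
    cases F with
    | nil => exact h.elim
    | cons f F =>
      refine ⟨?_, h.2⟩
      rw [hw (by simp)]
      exact h.1

/-- A state of the simulation: the actual configuration, the simulating word of `T`, and one
frame for every stack symbol. -/
structure SimState (Q Γ : Type*) (n : ℕ) where
  conf : Config Q Γ
  word : List (Config Q Γ)
  frames : List (List (Config Q Γ) × WithTop (Fin n))

variable (col i T e) in
/-- The invariant of the simulation. -/
structure SimState.Valid (s : SimState Q Γ n) : Prop where
  mem : s.word ∈ T
  reduced : Reduced col i T e s.word
  state_eq : (s.word.getLastD e).state = s.conf.state
  head_eq : (s.word.getLastD e).stack.head? = s.conf.stack.head?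
  pending : Pending col i T e s.conf.stack s.word s.frames

variable (col i) in
/-- The effect of one move on a state of the simulation. -/
def SimState.Next (s s' : SimState Q Γ n) : Prop :=
  (s'.frames = updateFrame (stateCol col s'.conf) s.frames ∧
    ExtendCut col i s.word (stateCol col s'.conf) s'.word) ∨
  (s'.frames = (s.word, (stateCol col s'.conf : WithTop (Fin n))) :: s.frames ∧
    ExtendCut col i s.word (stateCol col s'.conf) s'.word) ∨
  ∃ y d F, s.frames = (y, d) :: F ∧ s'.frames = updateFrame (min d (stateCol col s'.conf)) F ∧
    ExtendCut col i y (min d (stateCol col s'.conf)) s'.word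

/-- The length of `β` decides between pop, rewriting of the top, and push; over the bottom symbol
these lengths shift by one and no pop occurs. In each case the word is extended inside `T` and then
reduced. -/
theorem SimState.Valid.exists_next {s : SimState Q Γ n} (hs : s.Valid col i T e)
    (hpre : ∀ w u : List (Config Q Γ), w ≠ [] → w ++ u ∈ T → w ∈ T)
    {q' : Q} {β : List Γ} (hβ : β.length ≤ 2) (hβ' : s.conf.stack = [] → β.length ≤ 1)
    (hT : s.word ++ [⟨q', β ++ (s.word.getLastD e).stack.tail⟩] ∈ T) :
    ∃ s' : SimState Q Γ n, s'.Valid col i T e ∧ s.Next col i s' ∧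
      s'.conf = ⟨q', β ++ s.conf.stack.tail⟩ := by
  obtain ⟨⟨q, γ⟩, w, F⟩ := s
  obtain ⟨hmem, hred, hst, hhd, hpend⟩ := hs
  simp only at hmem hred hst hhd hpend hT hβ' ⊢
  obtain ⟨l, hl⟩ : ∃ l, w.getLastD e = l := ⟨_, rfl⟩
  have hl' : w.getLast?.getD e = l := by rw [← hl, List.getLastD_eq_getLast?]
  rw [hl] at hst hhd hT
  have key : ∀ (F' : List (List (Config Q Γ) × WithTop (Fin n))) (y u : List (Config Q Γ))
      (x : Config Q Γ), Reduced col i T e y → y ++ u ++ [x] ∈ T →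
      (∀ z ∈ u, x.stack.length < z.stack.length) →
      (y.getLastD e).stack.length ≤ x.stack.length → x.state = q' →
      x.stack.head? = (β ++ γ.tail).head? →
      Pending col i T e (β ++ γ.tail) (y ++ u ++ [x]) F' →
      ∃ w' , (⟨⟨q', β ++ γ.tail⟩, w', F'⟩ : SimState Q Γ n).Valid col i T e ∧
        ExtendCut col i y (minCol (stateCol col) (u ++ [x])) w' := by
    intro F' y u x h1 h2 h3 h4 h5 h6 h7
    obtain ⟨w', g1, g2, g3, g4, g5, g6⟩ := exists_reduced hpre h1 h2 h3 (by
      intro z hz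
      rw [List.getLastD_eq_getLast?, hz] at h4
      exact h4)
    refine ⟨w', ⟨g1, g2, g3.trans h5, g4.trans h6, h7.congr fun hne => g5 ?_⟩, g6⟩
    intro hx
    rw [hx] at h6
    exact hne (List.head?_eq_none_iff.mp h6.symm)
  have key1 : ∀ (F' : List (List (Config Q Γ) × WithTop (Fin n))),
      l.stack.length ≤ (β ++ l.stack.tail).length →
      (β ++ l.stack.tail).head? = (β ++ γ.tail).head? →
      Pending col i T e (β ++ γ.tail) (w ++ [⟨q', β ++ l.stack.tail⟩]) F' →
      ∃ w' , (⟨⟨q', β ++ γ.tail⟩, w', F'⟩ : SimState Q Γ n).Valid col i T e ∧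
        ExtendCut col i w (col q') w' := by
    intro F' h1 h2 h3
    have := key F' w [] ⟨q', β ++ l.stack.tail⟩ hred (by simpa using hT) (by simp) (hl ▸ h1) rfl h2
      (by simpa using h3)
    simpa using this
  have hlast : (w ++ [(⟨q', β ++ l.stack.tail⟩ : Config Q Γ)]).getLastD e =
    ⟨q', β ++ l.stack.tail⟩ := List.getLastD_concat
  -- pushing a symbol
  have push : ∀ B ε, β ++ γ.tail = B :: ε → ∀ ε', β ++ l.stack.tail = B :: ε' → ε'.head? = ε.head? → ε'.tail = l.stack.tail →
      ε'.length = l.stack.length → Pending col i T e ε w F →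
      ∃ s' : SimState Q Γ n, s'.Valid col i T e ∧ SimState.Next col i ⟨⟨q, γ⟩, w, F⟩ s' ∧
      s'.conf = ⟨q', β ++ γ.tail⟩ := by
    intro B ε hε ε' hε' h1 h2 h3 h4
    have hP : Pending col i T e (β ++ γ.tail) (w ++ [⟨q', β ++ l.stack.tail⟩])
        ((w, (col q' : WithTop (Fin n))) :: F) := by
      rw [hε]
      refine ⟨⟨hmem, hred, ε', h1, hl ▸ h2, hl ▸ h3, ?_⟩, h4⟩
      rintro ⟨p, c⟩ ⟨u, hu1, hu2, hu3, hu4⟩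
      rw [hlast] at hu2 hu3
      simp only [hε'] at hu1 hu2 hu3
      have hne := ne_nil_of_minCol_eq _ hu4
      rw [List.append_assoc] at hu1 hu2
      refine ⟨_, hu1, by rw [hu2]; rfl, ?_, ?_⟩
      · rw [hl]
        rw [List.dropLast_append_of_ne_nil hne]
        intro x hx
        rcases List.mem_append.mp hx with hx | hx
        · rw [List.mem_singleton.mp hx]
          simp [h3]
        · have := hu3 x hx
          simp only [List.length_cons, h3] at this
          omega
      · rw [minCol_append, hu4]
        simp
    obtain ⟨w', g1, g2⟩ := key1 _ (by rw [hε']; simp [h3]) (by rw [hε, hε']; rfl) hP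
    exact ⟨_, g1, Or.inr (Or.inl ⟨rfl, g2⟩), rfl⟩
  -- The height is unchanged: exits of the new word are exits of the old one after including `col
  -- q'`, which is what `updateFrame` records.
  have stay : (β ++ l.stack.tail).tail = l.stack.tail →
      l.stack.length = (β ++ l.stack.tail).length →
      (β ++ l.stack.tail).head? = (β ++ γ.tail).head? →
      Pending col i T e (β ++ γ.tail) w F →
      ∃ s' : SimState Q Γ n, s'.Valid col i T e ∧ SimState.Next col i ⟨⟨q, γ⟩, w, F⟩ s' ∧
      s'.conf = ⟨q', β ++ γ.tail⟩ := by
    intro h1 h2 h3 h4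
    obtain ⟨w', g1, g2⟩ := key1 (updateFrame (col q') F) h2.le h3 (h4.update fun p hp => by
      obtain ⟨c, hc, hc'⟩ := exits_append (by rw [hlast, hl, h1]) (by simpa [hl'] using h2.le) hp
      exact ⟨c, hc, by simpa using hc'⟩)
    exact ⟨_, g1, Or.inl ⟨rfl, g2⟩, rfl⟩
  cases γ with
  | nil =>
    have hls : l.stack = [] := by simpa using hhd
    have hF : F = [] := hpend
    subst hF
    have := hβ' rfl
    obtain rfl | ⟨B, rfl⟩ : β = [] ∨ ∃ B, β = [B] := by
      match β, this with
      | [], _ => simp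
      | [B], _ => simp
    · exact stay (by simp [hls]) (by simp [hls]) (by simp [hls]) rfl
    · exact push B [] rfl [] (by simp [hls]) rfl (by simp [hls]) (by simp [hls]) rfl
  | cons A γ =>
    obtain ⟨ε, hls⟩ : ∃ ε, l.stack = A :: ε := by
      cases h : l.stack with
      | nil => simp [h] at hhd
      | cons A' ε => simp [h] at hhd; exact ⟨ε, by rw [hhd]⟩
    obtain ⟨⟨y, d⟩, F, rfl⟩ : ∃ f F', F = f :: F' := by
      cases F with
      | nil => exact hpend.elim
      | cons f F => exact ⟨_, _, rfl⟩
    have hpend' := hpend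
    obtain ⟨⟨h1, h2, δ, h3, h4, h5, h6⟩, h7⟩ := hpend
    obtain rfl | ⟨B, rfl⟩ | ⟨B, C, rfl⟩ : β = [] ∨ (∃ B, β = [B]) ∨ ∃ B C, β = [B, C] := by
      match β, hβ with
      | [], _ => simp
      | [B], _ => simp
      | [B, C], _ => simp
    rotate_left
    · exact stay (by simp) (by simp [hls]) (by simp) hpend'
    · exact push B (C :: γ) rfl (C :: ε) (by simp [hls]) rfl
        (by simp [hls]) (by simp [hls]) hpend'
    -- Pop: the move itself is an exit of `w`, so the top frame supplies an extension `y ++ u` in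
    -- `T` with the state reached, the actual next top symbol, and least colour `min d (col q')`.
    -- The simulation resumes from `y`.
    · have hex : (q', col q') ∈ exits col T e w :=
        ⟨_, hT, by rw [hlast, hl]; rfl, by simp, by simp⟩
      obtain ⟨u, hu1, hu2, hu3, hu4⟩ := h6 _ hex
      have hne : u ≠ [] := by
        rintro rfl
        simp only [minCol_nil] at hu4
        have := hu4.le.trans (min_le_right _ _)
        exact absurd (top_le_iff.mp this) (WithTop.coe_ne_top)
      obtain ⟨u, x, rfl⟩ := (List.eq_nil_or_concat u).resolve_left hne
      rw [List.concat_eq_append] at *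
      rw [← List.append_assoc] at hu1 hu2
      rw [List.getLastD_concat] at hu2
      subst hu2
      rw [List.dropLast_concat] at hu3
      obtain ⟨w', g1, g2⟩ := key (updateFrame (min d (col q')) F) y u _ h2 hu1
        (by simpa [h5] using hu3) h5.ge rfl (by simpa using h3) (h7.update fun p hp => by
          rw [List.append_assoc] at hp
          obtain ⟨c, hc, hc'⟩ := exits_append (by
            rw [← List.append_assoc, List.getLastD_concat, h4]) (by
            intro z hz
            rcases List.mem_append.mp hz with hz | hz
            · exact (hu3 z hz).le
            · rw [List.mem_singleton.mp hz]; exact h5.ge) hp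
          exact ⟨c, hc, by rw [hc', hu4]⟩)
      exact ⟨_, g1, Or.inr (Or.inr ⟨y, d, F, rfl, rfl, by rw [hu4] at g2; exact g2⟩), rfl⟩

end Simulation

/-! ### Bounding the stair-scores of reduced words -/

section Pigeonhole

variable {Q Γ : Type*} [Finite Q] [Finite Γ] {n : ℕ} {col : Q → Fin n} {i : Fin 2}
  {T : Set (List (Config Q Γ))} {e : Config Q Γ}

/-- The counted types are those of the stairs after which no colour below `c` occurs. Bumps with
larger colours keep them all, and a bump with least colour `c` adds a type. -/
theorem Reduced.stairSc_le_ncard {c : Fin n} (hc : (c : ℕ) % 2 = i) (w : List (Config Q Γ))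
    (hw : Reduced col i T e w) :
    stairSc Config.sh (stateCol col) c w ≤ Set.ncard {τ | ∃ w₁, w₁ ≠ [] ∧
      Relation.ReflTransGen ResetStep w₁ w ∧ wordType col T e w₁ = τ ∧
      c ≤ minCol (stateCol col) (w.drop w₁.length)} := by
  induction hlen : w.length using Nat.strong_induction_on generalizing w with
  | _ N ih =>
  subst hlen
  rw [stairSc]
  split_ifs with h0 h1 h2
  · exact Nat.zero_le _
  all_goals try exact Nat.zero_le _
  all_goals
    have hstep : ResetStep (reset Config.sh w) w := ⟨h0, rfl⟩
    have hred := hw.of_resetSteps (Relation.ReflTransGen.single hstep)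
    have IH := ih _ (reset_length_lt Config.sh h0) _ hred rfl
    have hdrop : ∀ w₁, Relation.ReflTransGen ResetStep w₁ (reset Config.sh w) →
        minCol (stateCol col) (w.drop w₁.length) =
          min (minCol (stateCol col) ((reset Config.sh w).drop w₁.length))
            (minCol (stateCol col) (lastBump Config.sh w)) := by
      intro w₁ h
      rw [← minCol_append, ← List.drop_append_of_le_length (prefix_of_resetSteps h).length_le,
        reset_append_lastBump]
  · refine IH.trans (Set.ncard_le_ncard ?_ (Set.toFinite _))
    rintro τ ⟨w₁, g1, g2, g3, g4⟩
    exact ⟨w₁, g1, g2.tail hstep, g3, by rw [hdrop w₁ g2]; exact le_min g4 h1.le⟩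
  · refine (Nat.add_le_add_right IH 1).trans ?_
    -- The type of `w` is new: an earlier counted stair of that type would enclose with `w` a piece
    -- whose least colour is exactly `c`, of parity `i`.
    rw [← Set.ncard_insert_of_notMem (a := wordType col T e w) _ (Set.toFinite _)]
    · refine Set.ncard_le_ncard ?_ (Set.toFinite _)
      rintro τ (rfl | ⟨w₁, g1, g2, g3, g4⟩)
      · exact ⟨w, h0, Relation.ReflTransGen.refl, rfl, by simp⟩
      · exact ⟨w₁, g1, g2.tail hstep, g3, by rw [hdrop w₁ g2]; exact le_min g4 h2.ge⟩
    · rintro ⟨w₁, g1, g2, g3, g4⟩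
      refine hw w Relation.ReflTransGen.refl w₁ g1 (Relation.TransGen.tail' g2 hstep) g3
        ⟨c, ?_, hc⟩
      rw [hdrop w₁ g2, h2]
      exact min_eq_right g4

theorem Reduced.stairSc_le {c : Fin n} (hc : (c : ℕ) % 2 = i) {w : List (Config Q Γ)}
    (hw : Reduced col i T e w) : stairSc Config.sh (stateCol col) c w ≤
      Nat.card Q + Nat.card Q * (Nat.card Γ * 2 ^ (Nat.card Q * n)) := by
  refine (hw.stairSc_le_ncard hc).trans ((Set.ncard_le_card _).trans_eq ?_)
  rw [Nat.card_sum, Nat.card_prod, Nat.card_prod]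
  congr 3
  have := Fintype.ofFinite Q
  classical
  simp [Nat.card_eq_fintype_card]

end Pigeonhole

/-! ### The winner of a simulated play -/

section Runs

variable {Q Γ : Type*} {n : ℕ} {col : Q → Fin n} {i : Fin 2} {T : Set (List (Config Q Γ))}

theorem exists_count_le (hT : T.Finite) (m : Fin n) :
    ∃ K, ∀ w ∈ T, (w.map (stateCol col)).count m < K := by
  obtain ⟨K, hK⟩ := (hT.image fun w => (w.map (stateCol col)).count m).bddAbove
  exact ⟨K + 1, fun w hw => Nat.lt_succ_of_le (hK ⟨w, hw, rfl⟩)⟩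

/-- Past a shortest word `W J`, every later word extends `W J`. If `m` had the wrong parity, cuts
could never remove an `m` beyond that prefix, so each `j` with `M j = m` would increase the number
of its occurrences there. -/
theorem parity_of_extendCut (hT : T.Finite) {W : ℕ → List (Config Q Γ)} {M : ℕ → WithTop (Fin n)}
    (hW : ∀ j, W j ∈ T) (hE : ∀ j, ExtendCut col i (W j) (M j) (W (j + 1))) {m : Fin n}
    (hM : ∀ j, m ≤ M j) (hfreq : ∀ K, ∃ j, K ≤ j ∧ M j = m) : (m : ℕ) % 2 = i := by
  by_contra hbad
  obtain ⟨_, ⟨J, rfl⟩, hJ⟩ := wellFounded_lt.has_min (Set.range fun j => (W j).length)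
    ⟨_, 0, rfl⟩
  replace hJ : ∀ j, (W J).length ≤ (W j).length := fun j => not_lt.mp (hJ _ ⟨j, rfl⟩)
  have step : ∀ j x, W j = W J ++ x → m ≤ minCol (stateCol col) x →
      ∃ x', W (j + 1) = W J ++ x' ∧ m ≤ minCol (stateCol col) x' ∧
        (x.map (stateCol col)).count m ≤ (x'.map (stateCol col)).count m ∧
        (M j = m → (x.map (stateCol col)).count m < (x'.map (stateCol col)).count m) := by
    intro j x hx hmx
    obtain ⟨u, z, hu, huz, hz⟩ := hE j
    have hpre : W J <+: W (j + 1) := by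
      refine List.prefix_of_prefix_length_le (l₃ := W j ++ u) ?_ ?_ (hJ _)
      · rw [hx, List.append_assoc]; exact List.prefix_append _ _
      · rw [huz]; exact List.prefix_append _ _
    obtain ⟨x', hx'⟩ := hpre
    have heq : x ++ u = x' ++ z := by
      rw [hx, ← hx', List.append_assoc, List.append_assoc] at huz
      exact List.append_cancel_left huz
    have hmin : m ≤ minCol (stateCol col) (x' ++ z) := by
      rw [← heq, minCol_append, hu]
      exact le_min hmx (hM j)
    rw [minCol_append] at hmin
    -- All colours in `z` are at least `m`; an occurrence of `m` would make it the least colour of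
    -- `z`, which has parity `i`.
    have hcz : (z.map (stateCol col)).count m = 0 := by
      rcases hz with rfl | ⟨c, hc, hci⟩
      · simp
      · rw [List.count_eq_zero]
        intro hmem
        obtain ⟨v, hv, hvm⟩ := List.mem_map.mp hmem
        have h1 : (m : WithTop (Fin n)) ≤ c := hc ▸ hmin.trans (min_le_right _ _)
        have h2 : (c : WithTop (Fin n)) ≤ m := by
          rw [← hc, ← hvm]
          exact (le_minCol_iff _).mp le_rfl v hv
        have h3 : m = c := le_antisymm (by exact_mod_cast h1) (by exact_mod_cast h2)
        exact hbad (h3 ▸ hci)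
    have hcount := congrArg (fun l => (l.map (stateCol col)).count m) heq
    simp only [List.map_append, List.count_append, hcz, add_zero] at hcount
    refine ⟨x', hx'.symm, hmin.trans (min_le_left _ _), by omega, fun hMj => ?_⟩
    have := List.count_pos_iff.mpr (mem_of_minCol_eq _ (hu.trans hMj))
    omega
  have mono : ∀ d j x, W j = W J ++ x → m ≤ minCol (stateCol col) x →
      ∃ x', W (j + d) = W J ++ x' ∧ m ≤ minCol (stateCol col) x' ∧
        (x.map (stateCol col)).count m ≤ (x'.map (stateCol col)).count m := by
    intro d
    induction d with
    | zero => exact fun j x h1 h2 => ⟨x, h1, h2, le_rfl⟩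
    | succ d ih =>
      intro j x h1 h2
      obtain ⟨x', g1, g2, g3⟩ := ih j x h1 h2
      obtain ⟨x'', f1, f2, f3, _⟩ := step _ x' g1 g2
      exact ⟨x'', f1, f2, g3.trans f3⟩
  have unbdd : ∀ K, ∃ j x, W j = W J ++ x ∧ m ≤ minCol (stateCol col) x ∧
      K ≤ (x.map (stateCol col)).count m := by
    intro K
    induction K with
    | zero => exact ⟨J, [], by simp, by simp, by simp⟩
    | succ K ih =>
      obtain ⟨j, x, h1, h2, h3⟩ := ih
      obtain ⟨j', hj', hMj⟩ := hfreq j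
      obtain ⟨d, rfl⟩ := Nat.exists_eq_add_of_le hj'
      obtain ⟨x', g1, g2, g3⟩ := mono d j x h1 h2
      obtain ⟨x'', f1, f2, _, f3⟩ := step _ x' g1 g2
      exact ⟨_, x'', f1, f2, by have := f3 hMj; omega⟩
  obtain ⟨K, hK⟩ := exists_count_le (col := col) hT m
  obtain ⟨j, x, h1, _, h3⟩ := unbdd K
  have := hK _ (hW j)
  rw [h1, List.map_append, List.count_append] at this
  omega

/-- The least of the colours `c (a + 1), …, c b`. -/
def segMin (c : ℕ → Fin n) (a b : ℕ) : WithTop (Fin n) :=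
  (Finset.Ioc a b).inf fun s => (c s : WithTop (Fin n))

theorem segMin_succ (c : ℕ → Fin n) {a b : ℕ} (h : a ≤ b) :
    segMin c a (b + 1) = min (segMin c a b) (c (b + 1)) := by
  unfold segMin
  rw [← Finset.insert_Ioc_right_eq_Ioc_add_one (by omega), Finset.inf_insert, inf_comm]

theorem le_segMin {c : ℕ → Fin n} {a b : ℕ} {m : Fin n} (h : ∀ s, a < s → m ≤ c s) :
    (m : WithTop (Fin n)) ≤ segMin c a b :=
  Finset.le_inf fun s hs => WithTop.coe_le_coe.mpr (h s (Finset.mem_Ioc.mp hs).1)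

theorem segMin_le {c : ℕ → Fin n} {a b s : ℕ} (h1 : a < s) (h2 : s ≤ b) : segMin c a b ≤ c s :=
  Finset.inf_le (f := fun s => (c s : WithTop (Fin n))) (Finset.mem_Ioc.mpr ⟨h1, h2⟩)

/-- Between consecutive elements of `t`, the colour `m` is the least one infinitely often. -/
theorem exists_segMin_eq {c : ℕ → Fin n} {m : Fin n} (hm : ∃ᶠ t in Filter.atTop, c t = m)
    {t : ℕ → ℕ} (ht : ∀ j, t j < t (j + 1)) (hN : ∀ s, t 0 ≤ s → m ≤ c s) (K : ℕ) :
    ∃ j, K ≤ j ∧ segMin c (t j) (t (j + 1)) = m := by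
  have hmono : StrictMono t := strictMono_nat_of_lt_succ ht
  obtain ⟨s, hs, hcs⟩ := Filter.frequently_atTop.mp hm (t K + 1)
  have hex : ∃ j, s ≤ t j := ⟨s, hmono.id_le s⟩
  classical
  have h1 := Nat.find_spec hex
  have h2 : K < Nat.find hex := by
    by_contra hcon
    have := hmono.monotone (not_lt.mp hcon)
    omega
  obtain ⟨j, hj⟩ : ∃ j, Nat.find hex = j + 1 := ⟨Nat.find hex - 1, by omega⟩
  have h3 : t j < s := not_le.mp (Nat.find_min hex (by omega))
  refine ⟨j, by omega, le_antisymm ?_ (le_segMin fun r hr => hN r ?_)⟩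
  · rw [hj] at h1
    exact (segMin_le h3 h1).trans_eq (by rw [hcs])
  · exact (hmono.monotone (Nat.zero_le j)).trans hr.le

/-- Consecutive stairs are either one move apart or a push and its matching pop. In the second case
the pop returns to the frame created at `a`, whose colour has by then become the least colour of the
excursion. -/
theorem extendCut_of_next {s : ℕ → SimState Q Γ n} (hs : ∀ t, (s t).Next col i (s (t + 1)))
    {a b : ℕ} (hab : a < b) (ha : ∀ r, a ≤ r → (s a).frames.length ≤ (s r).frames.length)
    (hb : ∀ r, a < r → r < b → (s b).frames.length < (s r).frames.length) :
    ExtendCut col i (s a).word (segMin (fun t => stateCol col (s t).conf) a b) (s b).word := by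
  set c : ℕ → Fin n := fun t => stateCol col (s t).conf with hc
  have hseg1 : segMin c a (a + 1) = c (a + 1) := by
    rw [segMin_succ c le_rfl]; simp [segMin]
  have hupd : ∀ m (F : List (List (Config Q Γ) × WithTop (Fin n))),
      (updateFrame m F).length = F.length := by
    intro m F
    cases F <;> simp [updateFrame]
  obtain rfl | hab' : b = a + 1 ∨ a + 1 < b := by omega
  · rw [hseg1]
    rcases hs a with ⟨_, h⟩ | ⟨_, h⟩ | ⟨y, d, F, h1, h2, _⟩
    · exact h
    · exact h
    · have := ha (a + 1) (by omega)
      rw [h1, h2, hupd] at this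
      simp at this
  have hba := ha b hab.le
  have hpush : (s (a + 1)).frames = ((s a).word, (c (a + 1) : WithTop (Fin n))) :: (s a).frames := by
    have := hb (a + 1) (by omega) hab'
    rcases hs a with ⟨h1, _⟩ | ⟨h1, _⟩ | ⟨y, d, F, h1, h2, _⟩
    · rw [h1, hupd] at this; omega
    · exact h1
    · rw [h2, hupd] at this
      rw [h1, List.length_cons] at hba
      omega
  have hbeq : (s b).frames.length = (s a).frames.length := by
    have := hb (a + 1) (by omega) hab'
    rw [hpush, List.length_cons] at this
    omega
  -- A move's colour is entered only in the top frame and handed down at a pop, so the least colour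
  -- since `a` is the minimum over all frames above those of `a`.
  have claim : ∀ r, a < r → r < b → ∃ X d, (s r).frames = X ++ ((s a).word, d) :: (s a).frames ∧
      (X.map Prod.snd).foldr min d = segMin c a r := by
    intro r har
    induction r, har using Nat.le_induction with
    | base => exact fun _ => ⟨[], _, hpush, hseg1.symm⟩
    | succ r har ih =>
      intro hrb
      obtain ⟨X, d, hX, hmin⟩ := ih (by omega)
      have hlen := hb (r + 1) (by omega) hrb
      have hfold : ∀ (X : List (WithTop (Fin n))) (d m : WithTop (Fin n)),
          X.foldr min (min d m) = min (X.foldr min d) m := by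
        intro X d m
        induction X with
        | nil => rfl
        | cons x X ih => simp [ih, min_assoc]
      have hupdX : ∀ m (X : List (List (Config Q Γ) × WithTop (Fin n))) d, ∃ X' d',
          updateFrame m (X ++ ((s a).word, d) :: (s a).frames) =
            X' ++ ((s a).word, d') :: (s a).frames ∧
          (X'.map Prod.snd).foldr min d' = min ((X.map Prod.snd).foldr min d) m := by
        intro m X d
        cases X with
        | nil => exact ⟨[], min d m, rfl, rfl⟩
        | cons f X =>
          refine ⟨(f.1, min f.2 m) :: X, d, rfl, ?_⟩
          simp only [List.map_cons, List.foldr_cons]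
          rw [min_right_comm]
      rw [segMin_succ c (by omega), ← hmin]
      rcases hs r with ⟨h1, _⟩ | ⟨h1, _⟩ | ⟨y, d', F, h1, h2, _⟩
      · rw [h1, hX]
        exact hupdX _ _ _
      · refine ⟨((s r).word, (c (r + 1) : WithTop (Fin n))) :: X, d, by rw [h1, hX]; rfl, ?_⟩
        simp [min_comm]
      · cases X with
        | nil =>
          rw [hX] at h1
          simp only [List.nil_append, List.cons.injEq] at h1
          rw [h2, hupd, ← h1.2] at hlen
          omega
        | cons f X =>
          rw [hX] at h1
          simp only [List.cons_append, List.cons.injEq] at h1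
          obtain ⟨rfl, rfl⟩ := h1
          rw [h2]
          obtain ⟨X', d'', g1, g2⟩ := hupdX (min d' (c (r + 1))) X d
          refine ⟨X', d'', g1, g2.trans ?_⟩
          simp only [List.map_cons, List.foldr_cons]
          rw [← min_assoc, min_comm _ d']
  obtain ⟨r, rfl⟩ : ∃ r, b = r + 1 := ⟨b - 1, by omega⟩
  obtain ⟨X, d, hX, hmin⟩ := claim r (by omega) (by omega)
  have hlen : (s r).frames.length = X.length + 1 + (s a).frames.length := by
    rw [hX]; simp; omega
  rw [segMin_succ c (by omega), ← hmin]
  rcases hs r with ⟨h1, _⟩ | ⟨h1, _⟩ | ⟨y, d', F, h1, h2, h3⟩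
  · rw [h1, hupd] at hbeq; omega
  · rw [h1, List.length_cons] at hbeq; omega
  · have : X = [] := by
      rw [h2, hupd] at hbeq
      rw [h1, List.length_cons] at hlen
      exact List.length_eq_zero_iff.mp (by omega)
    subst this
    rw [hX] at h1
    simp only [List.nil_append, List.cons.injEq, Prod.mk.injEq] at h1
    obtain ⟨⟨rfl, rfl⟩, _⟩ := h1
    exact h3

end Runs

/-! ### From a finite tree to a winning strategy -/

section Main

variable {Q Γ : Type*} {n : ℕ} (P : PDS Q Γ) (owner : Q → Fin 2) (col : Q → Fin n)

/-- Player `i` wins the pushdown game if there is a finite tree of words, all of whose reduced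
elements can be prolonged within the tree in accordance with the rules. -/
theorem wins_of_tree {i : Fin 2} {T : Set (List (Config Q Γ))} (hfin : T.Finite)
    (hpre : ∀ w u : List (Config Q Γ), w ≠ [] → w ++ u ∈ T → w ∈ T)
    (hinit : [⟨P.init, []⟩] ∈ T)
    (hi : ∀ w ∈ T, Reduced col i T ⟨P.init, []⟩ w →
      owner (w.getLastD ⟨P.init, []⟩).state = i →
      ∃ x, P.Step (w.getLastD ⟨P.init, []⟩) x ∧ w ++ [x] ∈ T)
    (hj : ∀ w ∈ T, Reduced col i T ⟨P.init, []⟩ w →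
      owner (w.getLastD ⟨P.init, []⟩).state ≠ i →
      ∀ x, P.Step (w.getLastD ⟨P.init, []⟩) x → w ++ [x] ∈ T) :
    (P.game owner col).Wins i := by
  set e : Config Q Γ := ⟨P.init, []⟩ with he
  -- The initial word is obtained by extending the empty word, which is trivially reduced.
  obtain ⟨w₀, g1, g2, g3, g4, _, _⟩ := exists_reduced (w := []) (u := []) (x := e) hpre
    (Reduced.nil (col := col) (i := i) (e := e)) hinit (by simp) (by simp)
  have hnext : ∀ s : SimState Q Γ n, s.Valid col i T e → ∀ q' β,
      P.Move s.conf.state s.conf.stack.head? q' β →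
      s.word ++ [⟨q', β ++ (s.word.getLastD e).stack.tail⟩] ∈ T →
      ∃ s' : SimState Q Γ n, s'.Valid col i T e ∧ s.Next col i s' ∧
      s'.conf = ⟨q', β ++ s.conf.stack.tail⟩ := by
    intro s hs q' β hβ hT
    refine hs.exists_next hpre hβ.length_le_two (fun h => ?_) hT
    rw [h] at hβ
    exact hβ.length_le_one
  refine (P.game owner col).wins_of_memory (S := {s : SimState Q Γ n // s.Valid col i T e})
    (fun s => s.1.conf) (fun s s' => s.1.Next col i s'.1) ⟨⟨e, w₀, []⟩, g1, g2, g3, g4, rfl⟩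
    rfl ?_ ?_ ?_
  · rintro ⟨s, hs⟩ ho
    obtain ⟨⟨q', γ'⟩, hx, hxT⟩ := hi _ hs.mem hs.reduced (by rw [hs.state_eq]; exact ho)
    obtain ⟨β, hβ, rfl⟩ := P.step_iff.mp hx
    rw [hs.state_eq, hs.head_eq] at hβ
    obtain ⟨s', h1, h2, h3⟩ := hnext s hs q' β hβ hxT
    exact ⟨⟨s', h1⟩, h2, P.step_iff.mpr ⟨β, by rw [h3]; exact hβ, by rw [h3]⟩⟩
  · rintro ⟨s, hs⟩ ho ⟨q', γ'⟩ hv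
    obtain ⟨β, hβ, rfl⟩ := P.step_iff.mp hv
    have hT := hj _ hs.mem hs.reduced (by rw [hs.state_eq]; exact ho)
      ⟨q', β ++ (s.word.getLastD e).stack.tail⟩
      (P.step_iff.mpr ⟨β, by rw [hs.state_eq, hs.head_eq]; exact hβ, rfl⟩)
    obtain ⟨s', h1, h2, h3⟩ := hnext s hs q' β hβ hT
    exact ⟨⟨s', h1⟩, h2, h3⟩
  · intro s _ hs
    obtain ⟨m, hm, N, hN⟩ := exists_liminf fun t => stateCol col (s t).1.conf
    refine (P.game owner col).playWonBy_of_liminf hm hN ?_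
    obtain ⟨t, t1, t2, t3, t4⟩ := exists_stairs (fun t => (s t).1.frames.length) N
    refine parity_of_extendCut hfin (fun j => (s (t j)).2.mem)
      (fun j => extendCut_of_next (s := fun t => (s t).1) hs (t1 j) (t3 j) (t4 j))
      (fun j => le_segMin fun r hr => hN r ?_)
      (exists_segMin_eq hm t1 fun r hr => hN r (t2.trans hr))
    have := (strictMono_nat_of_lt_succ t1).monotone (Nat.zero_le j)
    omega

end Main

/-! ### Unbounded stair-scores along infinite paths -/

theorem range_map_split {V : Type*} {n : ℕ} (col : V → Fin n) (x : ℕ → V) {a b : ℕ} (hab : a < b) :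
    ∃ u, (List.range (b + 1)).map x = (List.range (a + 1)).map x ++ u ++ [x b] ∧
      (∀ y ∈ u, ∃ s, a < s ∧ s < b ∧ y = x s) ∧
      minCol col (u ++ [x b]) = segMin (fun s => col (x s)) a b := by
  induction b, hab using Nat.le_induction with
  | base =>
    refine ⟨[], by simp [List.range_succ], by simp, ?_⟩
    rw [segMin_succ _ le_rfl]
    simp [segMin]
  | succ b hb ih =>
    obtain ⟨u, h1, h2, h3⟩ := ih
    refine ⟨u ++ [x b], ?_, ?_, ?_⟩
    · rw [List.range_succ, List.map_append, h1]
      simp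
    · intro y hy
      rcases List.mem_append.mp hy with hy | hy
      · obtain ⟨s, hs1, hs2, hs3⟩ := h2 y hy
        exact ⟨s, hs1, by omega, hs3⟩
      · exact ⟨b, hb, by omega, List.mem_singleton.mp hy⟩
    · rw [minCol_append, h3, segMin_succ _ (by omega)]
      simp

/-- Along an infinite sequence, the stair-score of the least colour occurring infinitely often is
unbounded. -/
theorem exists_stairSc_ge {V : Type*} {n : ℕ} (sh : V → ℕ) (col : V → Fin n) (w : List V)
    (x : ℕ → V) : ∃ m, ∀ K, ∃ t, K ≤ stairSc sh col m (w ++ (List.range (t + 1)).map x) := by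
  obtain ⟨m, hm, N, hN⟩ := exists_liminf fun t => col (x t)
  obtain ⟨t, t1, t2, t3, t4⟩ := exists_stairs (fun t => sh (x t)) N
  have hmono := (strictMono_nat_of_lt_succ t1).monotone
  refine ⟨m, ?_⟩
  -- Each stair resets to the preceding one, and no colour below `m` occurs any more, so the score
  -- of `m` never falls.
  have step : ∀ j, stairSc sh col m (w ++ (List.range (t (j + 1) + 1)).map x) =
      stairSc sh col m (w ++ (List.range (t j + 1)).map x) +
        if segMin (fun s => col (x s)) (t j) (t (j + 1)) = m then 1 else 0 := by
    intro j
    obtain ⟨u, h1, h2, h3⟩ := range_map_split col x (t1 j)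
    have hle : (m : WithTop (Fin n)) ≤ segMin (fun s => col (x s)) (t j) (t (j + 1)) :=
      le_segMin fun s hs => hN s (t2.trans ((hmono (Nat.zero_le j)).trans hs.le))
    have hres : reset sh (w ++ (List.range (t (j + 1) + 1)).map x) =
        w ++ (List.range (t j + 1)).map x := by
      rw [h1, ← List.append_assoc, ← List.append_assoc]
      refine reset_append sh (fun y hy => ?_) (fun y hy => ?_)
      · obtain ⟨s, s1, s2, rfl⟩ := h2 y hy
        exact t4 j s s1 s2
      · rw [List.range_succ, List.map_append, ← List.append_assoc] at hy
        simp only [List.map_cons, List.map_nil, List.getLast?_concat, Option.some.injEq] at hy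
        rw [← hy]
        exact t3 j _ (t1 j).le
    have hbump : minCol col (lastBump sh (w ++ (List.range (t (j + 1) + 1)).map x)) =
        segMin (fun s => col (x s)) (t j) (t (j + 1)) := by
      rw [lastBump, hres, h1, List.append_assoc, ← List.append_assoc, List.drop_left, h3]
    rw [stairSc, dif_neg (by simp), hbump, hres]
    rcases hle.lt_or_eq with h | h
    · rw [if_pos h, if_neg h.ne', add_zero]
    · rw [if_neg h.not_lt, if_pos h.symm, if_pos h.symm]
  have mono : Monotone fun j => stairSc sh col m (w ++ (List.range (t j + 1)).map x) :=
    monotone_nat_of_le_succ fun j => by rw [step]; exact Nat.le_add_right _ _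
  have unbdd : ∀ K, ∃ j, K ≤ stairSc sh col m (w ++ (List.range (t j + 1)).map x) := by
    intro K
    induction K with
    | zero => exact ⟨0, Nat.zero_le _⟩
    | succ K ih =>
      obtain ⟨j, hj⟩ := ih
      obtain ⟨j', hjj', hj'⟩ := exists_segMin_eq hm t1 (fun s hs => hN s (t2.trans hs)) j
      refine ⟨j' + 1, ?_⟩
      rw [step, if_pos hj']
      exact Nat.add_le_add_right (hj.trans (mono hjj')) 1
  exact fun K => (unbdd K).imp' t fun _ h => h

theorem PDS.finite_step {Q Γ : Type*} [Finite Q] [Finite Γ] (P : PDS Q Γ) (v : Config Q Γ) :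
    {v' | P.Step v v'}.Finite := by
  refine Set.Finite.subset (Set.Finite.image
    (fun p : Q × List Γ => (⟨p.1, p.2 ++ v.stack.tail⟩ : Config Q Γ))
    (Set.finite_univ.prod (List.finite_length_le Γ 2))) ?_
  intro v' hv
  obtain ⟨β, h1, h2⟩ := P.step_iff.mp hv
  exact ⟨(v'.state, β), ⟨Set.mem_univ _, h1.length_le_two⟩, by
    ext1
    · rfl
    · exact h2.symm⟩

/-! ### Finiteness and determinacy of the finite-time game -/

namespace FiniteTime

variable {Q Γ : Type*} {n : ℕ} (G : ParityGame (Config Q Γ) n) (k : ℕ)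

variable {G k} in
theorem IsPosition.ne_nil {w : List (Config Q Γ)} (h : IsPosition G k w) : w ≠ [] := by
  rintro rfl
  simpa using h.1.1

variable {G k} in
theorem IsPosition.of_prefix {u w : List (Config Q Γ)} (h : IsPosition G k w) (hu : u ≠ [])
    (huw : u <+: w) : IsPosition G k u := by
  refine ⟨⟨?_, h.1.2.prefix huw⟩, fun c => ?_⟩
  · obtain ⟨t, rfl⟩ := huw
    rw [← h.1.1, List.head?_append_of_ne_nil _ hu]
  · refine (maxStairSc_mono _ _ c ?_).trans_lt (h.2 c)
    obtain ⟨t, rfl⟩ := huw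
    rcases List.eq_nil_or_concat t with rfl | ⟨t, x, rfl⟩
    · simp
    · rw [List.concat_eq_append, ← List.append_assoc, List.dropLast_concat]
      exact (List.dropLast_prefix u).trans (List.prefix_append _ _)

variable {G k} in
theorem IsPosition.edge {w : List (Config Q Γ)} {x : Config Q Γ} (hw : w ≠ [])
    (h : IsPosition G k (w ++ [x])) : G.edge (w.getLastD G.init) x := by
  obtain ⟨w, v, rfl⟩ := (List.eq_nil_or_concat w).resolve_left hw
  rw [List.concat_eq_append] at *
  have := h.1.2
  rw [List.append_assoc, List.isChain_append] at this
  rw [List.getLastD_concat]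
  simpa using this.2.1

variable {G k} in
theorem IsPosition.append {w : List (Config Q Γ)} {x : Config Q Γ} (h : IsPosition G k w)
    (hp : ¬ IsPlay G k w) (hx : G.edge (w.getLastD G.init) x) : IsPosition G k (w ++ [x]) := by
  refine ⟨⟨?_, ?_⟩, fun c => ?_⟩
  · rw [List.head?_append_of_ne_nil _ h.ne_nil, h.1.1]
  · refine List.isChain_append.mpr ⟨h.1.2, by simp, ?_⟩
    intro v hv y hy
    rw [Option.mem_def] at hv
    rw [List.getLastD_eq_getLast?, hv] at hx
    simp only [List.head?_cons, Option.mem_def, Option.some.injEq] at hy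
    exact hy ▸ hx
  · rw [List.dropLast_concat]
    exact (maxStairSc_le_of_dropLast _ _ (h.2 c)).lt_of_ne fun hc => hp ⟨h, c, hc⟩

theorem isPosition_init (hk : 0 < k) : IsPosition G k [G.init] := by
  refine ⟨⟨rfl, by simp⟩, fun c => ?_⟩
  refine lt_of_le_of_lt ((maxStairSc_le_iff _ _).mpr fun u hu => ?_) hk
  rw [List.prefix_nil.mp hu, stairSc_nil]

/-- There is no infinite sequence of moves in the finite-time game. -/
theorem wellFounded_move :
    WellFounded fun w' w : List (Config Q Γ) => IsPosition G k w' ∧ ∃ x, w' = w ++ [x] := by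
  rw [wellFounded_iff_isEmpty_descending_chain]
  refine ⟨fun ⟨f, hf⟩ => ?_⟩
  choose hpos x hx using hf
  have hfx : ∀ t, f t = f 0 ++ (List.range t).map x := by
    intro t
    induction t with
    | zero => simp
    | succ t ih => rw [hx, List.range_succ, List.map_append, ← List.append_assoc, ← ih]; rfl
  obtain ⟨m, hm⟩ := exists_stairSc_ge Config.sh G.col (f 0) x
  -- Positions can have score `k`, so `k + 1` is needed for a contradiction.
  obtain ⟨t, ht⟩ := hm (k + 1)
  rw [← hfx] at ht
  have h1 := maxStairSc_le_of_dropLast _ _ ((hpos t).2 m)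
  have h2 := stairSc_le_maxStairSc Config.sh G.col m (List.prefix_rfl (l := f (t + 1)))
  omega

/-- König's lemma by well-founded induction: finite branching, and no infinite branch. -/
theorem finite_positions (hG : ∀ v, {v' | G.edge v v'}.Finite) :
    {w | IsPosition G k w}.Finite := by
  have key : ∀ w : List (Config Q Γ), w ≠ [] → {w' | IsPosition G k w' ∧ w <+: w'}.Finite := by
    intro w
    induction w using (wellFounded_move G k).induction with
    | _ w ih =>
    intro hw
    have hfin : (⋃ x ∈ {x | G.edge (w.getLastD G.init) x},
        {w' | IsPosition G k w' ∧ w ++ [x] <+: w'}).Finite := by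
      refine (hG _).biUnion fun x _ => ?_
      by_cases hx : IsPosition G k (w ++ [x])
      · exact ih _ ⟨hx, x, rfl⟩ (by simp)
      · refine Set.finite_empty.subset fun w' hw' => ?_
        exact hx (hw'.1.of_prefix (by simp) hw'.2)
    refine (hfin.insert w).subset ?_
    rintro w' ⟨h1, t, rfl⟩
    cases t with
    | nil => exact Or.inl (List.append_nil w)
    | cons x t =>
      have hpre : w ++ [x] <+: w ++ x :: t := ⟨t, by simp⟩
      refine Or.inr (Set.mem_biUnion (x := x) ?_ ⟨h1, hpre⟩)
      exact (h1.of_prefix (by simp) hpre).edge hw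
  refine (key [G.init] (by simp)).subset fun w hw => ⟨hw, ?_⟩
  cases w with
  | nil => exact absurd rfl hw.ne_nil
  | cons v w =>
    have := hw.1.1
    simp only [List.head?_cons, Option.some.injEq] at this
    exact ⟨w, by rw [this]; rfl⟩

/-- The positions from which Player `i` can force a win in the finite-time game. -/
inductive Forces (i : Fin 2) : List (Config Q Γ) → Prop
  | play {w} (h : PlayWonBy G k i w) : Forces i w
  | own {w x} (hp : ¬ IsPlay G k w) (ho : G.owner (w.getLastD G.init) = i)
      (hx : G.edge (w.getLastD G.init) x) (h : Forces i (w ++ [x])) : Forces i w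
  | other {w} (hp : ¬ IsPlay G k w) (ho : G.owner (w.getLastD G.init) ≠ i)
      (h : ∀ x, G.edge (w.getLastD G.init) x → Forces i (w ++ [x])) : Forces i w

theorem exists_forces (w : List (Config Q Γ)) (hw : IsPosition G k w) :
    ∃ i, Forces G k i w := by
  induction w using (wellFounded_move G k).induction with
  | _ w ih =>
  by_cases hp : IsPlay G k w
  · obtain ⟨c, hc⟩ := hp.2
    exact ⟨⟨(c : ℕ) % 2, Nat.mod_lt _ two_pos⟩, .play ⟨c, hc, rfl⟩⟩
  · by_cases hex : ∃ x, G.edge (w.getLastD G.init) x ∧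
        Forces G k (G.owner (w.getLastD G.init)) (w ++ [x])
    · obtain ⟨x, hx, h⟩ := hex
      exact ⟨_, .own hp rfl hx h⟩
    · refine ⟨G.owner (w.getLastD G.init) + 1, .other hp (by grind) fun x hx => ?_⟩
      have hpos := hw.append hp hx
      obtain ⟨j, hj⟩ := ih _ ⟨hpos, x, rfl⟩ hpos
      have hne : j ≠ G.owner (w.getLastD G.init) := fun h => hex ⟨x, hx, h ▸ hj⟩
      have aux : ∀ j o : Fin 2, j ≠ o → j = o + 1 := by decide
      exact aux _ _ hne ▸ hj

theorem wins_of_forces {i : Fin 2} (h : Forces G k i [G.init]) : Wins G k i := by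
  classical
  let σ : List (Config Q Γ) → Config Q Γ := fun w =>
    if h : ∃ x, G.edge (w.getLastD G.init) x ∧ Forces G k i (w ++ [x]) then h.choose
    else (G.exists_edge (w.getLastD G.init)).choose
  have hσ : ∀ w, G.edge (w.getLastD G.init) (σ w) := by
    intro w
    simp only [σ]
    split_ifs with h
    · exact h.choose_spec.1
    · exact (G.exists_edge _).choose_spec
  refine ⟨σ, fun w v _ => by simpa using hσ (w ++ [v]), fun w hw hc => ?_⟩
  have key : ∀ u, u ≠ [] → u <+: w → Forces G k i u := by
    intro u
    induction u using List.reverseRecOn with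
    | nil => exact fun h => absurd rfl h
    | append_singleton u x ih =>
      intro _ hu
      have hposx : IsPosition G k (u ++ [x]) := hw.1.of_prefix (by simp) hu
      rcases List.eq_nil_or_concat u with rfl | ⟨u', v, hu'⟩
      · have := hposx.1.1
        simp only [List.nil_append, List.head?_cons, Option.some.injEq] at this
        rw [this]
        exact h
      · rw [List.concat_eq_append] at hu'
        have hne : u ≠ [] := by simp [hu']
        have hlast : u.getLastD G.init = v := by rw [hu', List.getLastD_concat]
        have hnp : ¬ IsPlay G k u := by
          rintro ⟨_, c, hcu⟩
          have := hposx.2 c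
          rw [List.dropLast_concat] at this
          omega
        cases ih hne ((List.prefix_append _ _).trans hu) with
        | play hplay =>
          obtain ⟨c, hc, _⟩ := hplay
          exact absurd ⟨hposx.of_prefix hne (List.prefix_append _ _), c, hc⟩ hnp
        | own hp ho hx' hf =>
          have hex : ∃ x, G.edge (u.getLastD G.init) x ∧ Forces G k i (u ++ [x]) := ⟨_, hx', hf⟩
          have := hc u' v x (by rw [hu'] at hu; simpa using hu) (by rwa [← hlast])
          rw [this, ← hu']
          simp only [σ, dif_pos hex]
          exact hex.choose_spec.2
        | other hp ho hf => exact hf x (hposx.edge hne)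
  cases key w hw.1.ne_nil List.prefix_rfl with
  | play h => exact h
  | own hp => exact absurd hw hp
  | other hp => exact absurd hw hp

/-- Finite-time games are determined. -/
theorem exists_wins (hk : 0 < k) : ∃ i, Wins G k i :=
  (exists_forces G k _ (isPosition_init G k hk)).imp fun _ h => wins_of_forces G k h

end FiniteTime

/-! ### Transfer of winning strategies -/

open FiniteTime in
/-- A winning strategy in the finite-time game yields one in the pushdown game. -/
theorem wins_of_finiteTime_wins {Q Γ : Type*} [Finite Q] [Finite Γ] {n : ℕ} (P : PDS Q Γ)
    (owner : Q → Fin 2) (col : Q → Fin n) {k : ℕ} {i : Fin 2} (hk0 : 0 < k)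
    (hk : ∀ c : Fin n, (c : ℕ) % 2 = i →
      Nat.card Q + Nat.card Q * (Nat.card Γ * 2 ^ (Nat.card Q * n)) < k)
    (h : Wins (P.game owner col) k i) : (P.game owner col).Wins i := by
  set G := P.game owner col with hG
  obtain ⟨σ, hσ, hwin⟩ := h
  set T : Set (List (Config Q Γ)) := {w | IsPosition G k w ∧ G.FinConsistent i σ w} with hT
  -- In a play consistent with `σ` the full word itself has score `k` for some colour of parity `i`,
  -- which exceeds the bound for reduced words.
  have hnp : ∀ w ∈ T, Reduced col i T ⟨P.init, []⟩ w → ¬ IsPlay G k w := by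
    intro w hw hred hp
    obtain ⟨c, hc, hci⟩ := hwin w hp hw.2
    have h1 := hw.1.2 c
    rw [maxStairSc_eq_max] at hc
    have h2 : stairSc Config.sh (stateCol col) c w ≤ _ := hred.stairSc_le hci
    have h3 : stairSc Config.sh G.col c w = stairSc Config.sh (stateCol col) c w := rfl
    have h4 := hk c hci
    omega
  refine wins_of_tree P owner col (T := T) ?_ ?_ ?_ ?_ ?_
  · exact (finite_positions G k P.finite_step).subset fun w hw => hw.1
  · intro w u hw hwu
    exact ⟨hwu.1.of_prefix hw (List.prefix_append _ _),
      fun u' v v' h => hwu.2 u' v v' (h.trans (List.prefix_append _ _))⟩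
  · refine ⟨isPosition_init G k hk0, fun u v v' h => ?_⟩
    have := h.length_le
    simp at this
  · intro w hw hred ho
    have hedge : P.Step (w.getLastD ⟨P.init, []⟩) (σ w) := by
      obtain ⟨w', v, rfl⟩ := (List.eq_nil_or_concat w).resolve_left hw.1.ne_nil
      rw [List.concat_eq_append] at *
      rw [List.getLastD_concat] at ho ⊢
      exact hσ w' v ho
    refine ⟨σ w, hedge, hw.1.append (hnp w hw hred) hedge, fun u v v' h hv => ?_⟩
    rcases List.prefix_concat_iff.mp h with h | h
    · have h' : (u ++ [v]) ++ [v'] = w ++ [σ w] := by simpa using h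
      obtain ⟨h1, h2⟩ := List.append_inj' h' rfl
      rw [h1]
      simpa using h2
    · exact hw.2 u v v' h hv
  · intro w hw hred ho x hx
    refine ⟨hw.1.append (hnp w hw hred) hx, fun u v v' h hv => ?_⟩
    rcases List.prefix_concat_iff.mp h with h | h
    · have h' : (u ++ [v]) ++ [v'] = w ++ [x] := by simpa using h
      obtain ⟨h1, h2⟩ := List.append_inj' h' rfl
      rw [← h1, List.getLastD_concat] at ho
      exact absurd hv ho
    · exact hw.2 u v v' h hv

/-- If `0` is the only colour, Player `0` wins. -/
theorem ParityGame.wins_zero_of_one_color {V : Type*} (G : ParityGame V 1) : G.Wins 0 := by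
  choose f hf using G.exists_edge
  refine ⟨fun w => f (w.getLastD G.init), fun w v _ => by simpa using hf v, fun ρ _ _ => ?_⟩
  exact G.playWonBy_of_liminf (m := 0)
    (Filter.Frequently.of_forall fun t => Subsingleton.elim _ _)
    (N := 0) (fun t _ => Fin.zero_le _) rfl

end PushdownParity

theorem mainTheorem1 {Q Γ : Type*} [Fintype Q] [Fintype Γ] [Nonempty Γ] {n : ℕ}
    (P : PushdownParity.PDS Q Γ) (owner : Q → Fin 2) (col : Q → Fin n) (k : ℕ)
    (hk : Fintype.card Q * Fintype.card Γ * 2 ^ (Fintype.card Q * n) * n < k) :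
    (∀ i : Fin 2, (P.game owner col).Wins i ↔
      PushdownParity.FiniteTime.Wins (P.game owner col) k i) ∧
    {w | PushdownParity.FiniteTime.IsPosition (P.game owner col) k w}.Finite := by
  have hk0 : 0 < k := by omega
  have main : ∀ i, PushdownParity.FiniteTime.Wins (P.game owner col) k i →
      (P.game owner col).Wins i := by
    intro i hi
    -- The factor `n` in the threshold pays for the extra `|Q|` types at the bottom of the stack
    -- only if `n ≥ 2`. For `n = 1`, Player `0` wins outright, and for Player `1` the required bound
    -- is vacuous.
    obtain rfl | rfl | hn : n = 0 ∨ n = 1 ∨ 2 ≤ n := by omega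
    · exact (col P.init).elim0
    · obtain rfl | rfl : i = 0 ∨ i = 1 := by omega
      · exact PushdownParity.ParityGame.wins_zero_of_one_color _
      · refine PushdownParity.wins_of_finiteTime_wins P owner col hk0 (fun c hc => ?_) hi
        obtain rfl := Subsingleton.elim c 0
        simp at hc
    · refine PushdownParity.wins_of_finiteTime_wins P owner col hk0
        (fun _ _ => lt_of_le_of_lt ?_ hk) hi
      rw [Nat.card_eq_fintype_card, Nat.card_eq_fintype_card,
        mul_assoc (Fintype.card Q) (Fintype.card Γ)]
      set a := Fintype.card Γ * 2 ^ (Fintype.card Q * n)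
      -- Nonemptiness of `Γ` enters here.
      have ha : 1 ≤ a := Nat.mul_pos Fintype.card_pos (by positivity)
      calc Fintype.card Q + Fintype.card Q * a
          ≤ Fintype.card Q * a + Fintype.card Q * a :=
            Nat.add_le_add_right (Nat.le_mul_of_pos_right _ ha) _
        _ = Fintype.card Q * a * 2 := (mul_two _).symm
        _ ≤ Fintype.card Q * a * n := Nat.mul_le_mul_left _ hn
  refine ⟨fun i => ⟨fun hi => ?_, main i⟩, ?_⟩
  -- If the other player won the finite-time game, that player would win the infinite game as well,
  -- which Player `i` already wins.
  · obtain ⟨j, hj⟩ := PushdownParity.FiniteTime.exists_wins (P.game owner col) k hk0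
    by_cases hij : j = i
    · exact hij ▸ hj
    · refine ((P.game owner col).not_wins_both fun l => ?_).elim
      obtain rfl | rfl : l = i ∨ l = j := by omega
      · exact hi
      · exact main _ hj
  · exact PushdownParity.FiniteTime.finite_positions _ k P.finite_step
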